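/- **Setting.** Let $K\ge 2$ and $T\ge 2K$ be integers, let $G=([K],E)$ be a fixed known directed graph in which every node has a self-loop (a *self-aware* graph), and let $\ell_1,\dots,\ell_T\in[0,1]^K$ be loss vectors fixed in advance. Write $N^{\rm in}(i)=\{j:(j,i)\in E\}$. In each round $t$ a learner draws an arm $i_t$ from a distribution $p_t$ on $[K]$, incurs $\ell_{t,i_t}$, and then observes $\ell_{t,i}$ for exactly those $i$ with $i_t\in N^{\rm in}(i)$. Let $L_i=\sum_{t=1}^T\ell_{t,i}$, let $i^\star$ be an arm minimizing $L_i$, $L_\star=L_{i^\star}$, and $\mathrm{Reg}=\mathbb E\big[\sum_{t=1}^T\ell_{t,i_t}\big]-L_\star$. Let $\alpha$ be the independence number of $G$ (the largest size of a set of nodes with no edge, in either direction, between distinct nodes). Let $\mathcal C_1,\dots,\mathcal C_\kappa$ be a partition of $[K]$ into nonempty cliques (sets in which any two distinct nodes are joined by edges in both directions); for a smallest such partition $\kappa$ is the clique partition number of $G$. Let $\Delta(K)$ be the probability simplex and $D_\psi$ the Bregman divergence of $\psi$. **Algorithm** (input: $T$, $G$, the clique partition; in particular not $L_\star$). *First stage.*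 For meta-epochs $m=1,2,\dots,\lfloor\log_2 T\rfloor$: set $\eta=\frac1{4\kappa}$, $\epsilon=\frac1{2\kappa}$ and start an epoch. At the start of an epoch set $p_t=\hat p_t=\frac1K\mathbf 1$. In each round $t$ of the epoch: 1. draw $i_t\sim p_t$, and set $\hat\ell_{t,i}=\frac{\ell_{t,i}\,\mathbf 1\{i_t\in N^{\rm in}(i)\}}{\sum_{j\in N^{\rm in}(i)}p_{t,j}}$ if $p_{t,i}>0$ and $\hat\ell_{t,i}=0$ if $p_{t,i}=0$; 2. let $\hat p_{t+1}=\arg\min_{p\in\Delta(K)}\langle p,\hat\ell_t\rangle+D_\psi(p,\hat p_t)$ with $\psi(p)=\frac1\eta\sum_i p_i\ln p_i$, and obtain $p_{t+1}$ from $\hat p_{t+1}$ by setting to zero all coordinates in each clique $\mathcal C_j$ with $\sum_{i\in\mathcal C_j}\hat p_{t+1,i}\le\epsilon$ and renormalizing; 3. if $\frac1\eta\le 4\eta\kappa\min_i\sum_\tau\hat\ell_{\tau,i}$, the sum being over the rounds of the current epoch up to $t$, replace $\eta$ by $\eta/2$ and $\epsilon$ by $\max\{2\eta,\frac1T\}$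 (with the new $\eta$); then, if $\eta\le\sqrt{1/(\alpha T)}$, start the next meta-epoch, and otherwise start a new epoch in the same meta-epoch. *Second stage.* After the last meta-epoch, run from scratch for the remaining rounds online mirror descent on $\Omega=\{p\in\Delta(K):p_i\ge\frac1T\ \forall i\}$ with regularizer $\psi(p)=\frac1\eta\sum_i p_i\ln p_i+64K\sum_i\ln\frac1{p_i}$, $\eta=1/\sqrt{\alpha T}$: the first distribution is $\arg\min_{p\in\Omega}\psi(p)$, $i_t\sim p_t$, and $p_{t+1}=\arg\min_{p\in\Omega}\langle p,\hat\ell_t\rangle+D_\psi(p,p_t)$ with $\hat\ell_{t,i}=\frac{\ell_{t,i}\mathbf 1\{i_t\in N^{\rm in}(i)\}}{\sum_{j\in N^{\rm in}(i)}p_{t,j}}$. **Theorem.** There are universal constants $c>0$ and $d\in\mathbb N$ such that for all $K,T,G$, clique partitions and losses as above, the algorithm satisfies $$\mathrm{Reg}\ \le\ c\,\big(\ln(KT)\big)^{d}\Big(\min\big\{\sqrt{\alpha T},\sqrt{\kappa L_\star}\big\}+K^2\Big),$$ that is, $\mathrm{Reg}=\tilde{\mathcal O}\big(\min\{\sqrt{\alpha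 T},\sqrt{\kappa L_\star}\}+K^2\big)$. In particular this holds with $\kappa$ the clique partition number of $G$ if the given partition is a smallest one. -/

import Mathlib

noncomputable section

namespace GraphBandit

open scoped Classical

/-! ### Feedback graphs -/

/-- Every node has a self-loop. -/
def SelfAware {K : ℕ} (G : Digraph (Fin K)) : Prop :=
  ∀ i, G.Adj i i

/-- No edge, in either direction, between two distinct nodes of `I`. -/
def IsIndependent {K : ℕ} (G : Digraph (Fin K)) (I : Finset (Fin K)) : Prop :=
  ∀ i ∈ I, ∀ j ∈ I, i ≠ j → ¬ G.Adj i j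

/-- The independence number: the size of a largest independent set. -/
def independenceNumber {K : ℕ} (G : Digraph (Fin K)) : ℕ :=
  ((Finset.univ : Finset (Finset (Fin K))).filter (IsIndependent G)).sup Finset.card

/-- All edges, in both directions, between two distinct nodes of `C`. -/
def IsClique {K : ℕ} (G : Digraph (Fin K)) (C : Finset (Fin K)) : Prop :=
  ∀ i ∈ C, ∀ j ∈ C, i ≠ j → G.Adj i j

/-- A partition of the nodes into (nonempty) cliques. For a self-aware graph the subgraph
induced on the nodes with a self-loop is the whole graph. -/
def IsCliquePartition {K : ℕ} (G : Digraph (Fin K))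
    (P : Finpartition (Finset.univ : Finset (Fin K))) : Prop :=
  ∀ C ∈ P.parts, IsClique G C

/-- The clique partition number: the size of a smallest clique partition. -/
def cliquePartitionNumber {K : ℕ} (G : Digraph (Fin K)) : ℕ :=
  sInf {n | ∃ P : Finpartition (Finset.univ : Finset (Fin K)),
    IsCliquePartition G P ∧ P.parts.card = n}

/-! ### The online learning protocol -/

/-- What the learner sees after playing `a` when the loss vector is `l`: the loss of every arm
`i` with an edge from `a` to `i`, and nothing about the other arms. -/
def feedback {K : ℕ} (G : Digraph (Fin K)) (l : Fin K → ℝ) (a : Fin K) : Fin K → Option ℝ :=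
  fun i => if G.Adj a i then some (l i) else none

/-- A randomized learner: an internal state, the distribution from which the arm is drawn in a
given state, and the update of the state from the arm played and the feedback received. -/
structure Learner (K : ℕ) where
  State : Type
  init : State
  play : State → Fin K → ℝ
  update : State → Fin K → (Fin K → Option ℝ) → State

/-- The state before round `t` (rounds are numbered from `0`) if the arms played are `a`. -/
def Learner.stateAt {K T : ℕ} (A : Learner K) (G : Digraph (Fin K)) (l : Fin T → Fin K → ℝ)
    (a : Fin T → Fin K) : ℕ → A.State
  | 0 => A.init
  | t + 1 =>
    if h : t < T then
      A.update (A.stateAt G l a t) (a ⟨t, h⟩) (feedback G (l ⟨t, h⟩) (a ⟨t, h⟩))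
    else A.stateAt G l a t

/-- The probability that the arms played in rounds `0, …, T - 1` are `a`. -/
def Learner.prob {K T : ℕ} (A : Learner K) (G : Digraph (Fin K)) (l : Fin T → Fin K → ℝ)
    (a : Fin T → Fin K) : ℝ :=
  ∏ t : Fin T, A.play (A.stateAt G l a t) (a t)

/-- The total loss of arm `i`. -/
def totalLoss {K T : ℕ} (l : Fin T → Fin K → ℝ) (i : Fin K) : ℝ :=
  ∑ t, l t i

/-- The expected regret with respect to arm `i`. -/
def Learner.regret {K T : ℕ} (A : Learner K) (G : Digraph (Fin K)) (l : Fin T → Fin K → ℝ)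
    (i : Fin K) : ℝ :=
  ∑ a : Fin T → Fin K, A.prob G l a * (∑ t, l t (a t) - totalLoss l i)

/-! ### Online mirror descent -/

/-- A minimizer of `f` over `Ω`. Below, `f` is always continuous and strictly convex and `Ω` is
compact, convex and nonempty, so that there is exactly one. -/
def argminOn {K : ℕ} (f : (Fin K → ℝ) → ℝ) (Ω : Set (Fin K → ℝ)) : Fin K → ℝ :=
  Classical.epsilon fun p => p ∈ Ω ∧ IsMinOn f Ω p

/-- The Bregman divergence of `ψ`. -/
def bregman {K : ℕ} (ψ : (Fin K → ℝ) → ℝ) (x y : Fin K → ℝ) : ℝ :=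
  ψ x - ψ y - fderiv ℝ ψ y (x - y)

/-- One step of online mirror descent from `p` with loss estimate `e`. -/
def omdStep {K : ℕ} (ψ : (Fin K → ℝ) → ℝ) (Ω : Set (Fin K → ℝ)) (e p : Fin K → ℝ) :
    Fin K → ℝ :=
  argminOn (fun q => ∑ i, q i * e i + bregman ψ q p) Ω

/-- The entropy regularizer. -/
def entropyReg {K : ℕ} (η : ℝ) (p : Fin K → ℝ) : ℝ :=
  1 / η * ∑ i, p i * Real.log (p i)

/-- The entropy regularizer plus a log-barrier. -/
def hybridReg {K : ℕ} (η c : ℝ) (p : Fin K → ℝ) : ℝ :=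
  1 / η * ∑ i, p i * Real.log (p i) + c * ∑ i, Real.log (1 / p i)

/-- The points of the simplex with all coordinates at least `1 / T`. -/
def clippedSimplex (K T : ℕ) : Set (Fin K → ℝ) :=
  {p | p ∈ stdSimplex ℝ (Fin K) ∧ ∀ i, 1 / (T : ℝ) ≤ p i}

/-- The uniform distribution. -/
def uniform (K : ℕ) : Fin K → ℝ := fun _ => 1 / (K : ℝ)

/-- The importance-weighted loss estimator: the observed loss of arm `i` divided by the
probability of observing it, and `0` if the loss of `i` is not observed. -/
def estimator {K : ℕ} (G : Digraph (Fin K)) (p : Fin K → ℝ) (fb : Fin K → Option ℝ)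
    (i : Fin K) : ℝ :=
  match fb i with
  | some x => x / ∑ j, if G.Adj j i then p j else 0
  | none => 0

/-! ### The algorithm -/

/-- The distribution `q` after setting to zero the cliques of mass at most `ε`, before
renormalization. -/
def clipped {K : ℕ} (P : Finpartition (Finset.univ : Finset (Fin K))) (ε : ℝ)
    (q : Fin K → ℝ) (i : Fin K) : ℝ :=
  if ∑ j ∈ P.part i, q j ≤ ε then 0 else q i

/-- The distribution `q` after clipping and renormalization. -/
def clip {K : ℕ} (P : Finpartition (Finset.univ : Finset (Fin K))) (ε : ℝ)
    (q : Fin K → ℝ) (i : Fin K) : ℝ :=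
  clipped P ε q i / ∑ j, clipped P ε q j

/-- The variables of the first stage. -/
structure ExploreState (K : ℕ) where
  /-- index of the current meta-epoch -/
  m : ℕ
  /-- learning rate -/
  η : ℝ
  /-- clipping threshold -/
  ε : ℝ
  /-- the unclipped distribution -/
  pHat : Fin K → ℝ
  /-- the clipped distribution, from which the arm is drawn -/
  p : Fin K → ℝ
  /-- sum of the loss estimates since the beginning of the current epoch -/
  cum : Fin K → ℝ

/-- The state of the algorithm: the first stage, or the second stage with the current point of
the mirror descent. -/
inductive TwoStageState (K : ℕ) where
  | explore (s : ExploreState K)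
  | exploit (p : Fin K → ℝ)

/-- The first round of an epoch in meta-epoch `m`. -/
def startEpoch (K m : ℕ) (η ε : ℝ) : TwoStageState K :=
  .explore { m := m, η := η, ε := ε, pHat := uniform K, p := uniform K, cum := 0 }

/-- The learning rate of the second stage. -/
def rate2 {K : ℕ} (T : ℕ) (G : Digraph (Fin K)) : ℝ :=
  1 / √((independenceNumber G : ℝ) * T)

/-- The regularizer of the second stage. -/
def reg2 {K : ℕ} (T : ℕ) (G : Digraph (Fin K)) : (Fin K → ℝ) → ℝ :=
  hybridReg (rate2 T G) (64 * K)

/-- Meta-epoch `m` is begun if `m ≤ log₂ T`; otherwise the second stage is begun, from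
scratch. -/
def startMetaEpoch {K : ℕ} (T : ℕ) (G : Digraph (Fin K)) (ηinit εinit : ℝ) (m : ℕ) :
    TwoStageState K :=
  if m ≤ Nat.log 2 T then startEpoch K m ηinit εinit
  else .exploit (argminOn (reg2 T G) (clippedSimplex K T))

/-- The end of a round of the first stage. -/
def exploreUpdate {K : ℕ} (T : ℕ) (G : Digraph (Fin K))
    (P : Finpartition (Finset.univ : Finset (Fin K))) (ηinit εinit : ℝ)
    (s : ExploreState K) (fb : Fin K → Option ℝ) : TwoStageState K :=
  let e : Fin K → ℝ := fun i => if 0 < s.p i then estimator G s.p fb i else 0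
  let q := omdStep (entropyReg s.η) (stdSimplex ℝ (Fin K)) e s.pHat
  let cum := s.cum + e
  if 1 / s.η ≤ 4 * s.η * P.parts.card * ⨅ i, cum i then
    if s.η / 2 ≤ √(1 / ((independenceNumber G : ℝ) * T)) then
      startMetaEpoch T G ηinit εinit (s.m + 1)
    else
      startEpoch K s.m (s.η / 2) (max (2 * (s.η / 2)) (1 / T))
  else
    .explore { s with pHat := q, p := clip P s.ε q, cum := cum }

/-- The two-stage algorithm for horizon `T`, graph `G` and clique partition `P`, with initial
learning rate `ηinit` and initial clipping threshold `εinit`. -/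
def twoStage {K : ℕ} (T : ℕ) (G : Digraph (Fin K))
    (P : Finpartition (Finset.univ : Finset (Fin K))) (ηinit εinit : ℝ) : Learner K where
  State := TwoStageState K
  init := startMetaEpoch T G ηinit εinit 1
  play
    | .explore s => s.p
    | .exploit p => p
  update
    | .explore s, _, fb => exploreUpdate T G P ηinit εinit s fb
    | .exploit p, _, fb =>
      .exploit (omdStep (reg2 T G) (clippedSimplex K T) (estimator G p fb) p)

end GraphBandit

end

noncomputable section

namespace GraphBandit

open scoped Classical

/-! ### Potential functions for learners -/

/-! The regret is bounded by a potential: a function of the round and the state that dominates the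
expected instantaneous regret plus its own expected next value (`Learner.regret_le_of_potential`).
Random epoch lengths then need no stopping times; everything reduces to inequalities for a single
round.

Inside an epoch the unclipped iterate is exponential weights (`omdStep_softmax`), so its estimated
loss is at most the growth of `softMin` over all arms plus `η / 2` times the second-order term. In a
surviving clique `C` of mass `q(C)`, mutual observation gives `e i ≤ 1 / q(C)`. Hence `q i * e i ^
2` is at most the loss of exponential weights restricted to `C`, which is paid for by the growth of
the soft minimum over `C`. Survival means `q(C) > 2η`, so this soft minimum is within `O(log T / η)`
of the global one. Capping it there loses nothing while `C` survives and keeps the total growth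
bounded when `C` is dead (`sum_mul_exploreEstimate_le_potential`). An epoch therefore costs about `1
/ η + η κ min L`, up to logarithms, and the restart test stops it while the second term is at most
of the order of the first (`epochPotential_nonneg`, `ExploreInv.round`).

Across epochs, `explorePotential` adds a budget for the later epochs of the meta-epoch, where the
costs form a geometric series, a budget `A` per meta-epoch, and a price `b` on the estimated loss of
the comparator so far plus its true loss to come. At a constant price the expectation of that sum
never increases, since clipping only biases estimates downwards. `Budget` collects what `A` and `b`
must satisfy, and `regret_le_of_budget` turns it into a regret bound. In the second stage the
entropy alone gives stability, with a second-order term of order `α log T` by a greedy independent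
set (`sum_div_obsProb_le`).

Two choices of budgets finish. With `b = 0`, each of the `log T` meta-epochs costs `O(√(αT) + κ)` up
to logarithms. If instead `32 κ L ≤ αT`, finishing a meta-epoch forces the comparator's estimated
loss to be at least `2 L`, although its expectation is at most `L`. As in Markov's inequality, each
meta-epoch ends with probability at most one half, so the second stage is reached with probability
`O(1/T)`; this is encoded by a price that doubles from one meta-epoch to the next. If `32 κ L ≥ αT`,
the two terms of the minimum satisfy `√(αT) ≤ 6 √(κL)` and the first choice suffices
(`regret_le_min`). -/

theorem Learner.stateAt_cons {K T : ℕ} (A : Learner K) (G : Digraph (Fin K))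
    (l : Fin (T + 1) → Fin K → ℝ) (a₀ : Fin K) (a : Fin T → Fin K) (t : ℕ) :
    A.stateAt G l (Fin.cons a₀ a) (t + 1) =
      ({ A with init := A.update A.init a₀ (feedback G (l 0) a₀) } : Learner K).stateAt G
        (fun τ => l τ.succ) a t := by
  induction t with
  | zero => simp [Learner.stateAt]
  | succ t ih =>
    rw [Learner.stateAt, ih]
    conv_rhs => rw [Learner.stateAt]
    by_cases h : t < T
    · have h' : t + 1 < T + 1 := by omega
      rw [dif_pos h, dif_pos h']
      rfl
    · have h' : ¬ t + 1 < T + 1 := by omega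
      rw [dif_neg h, dif_neg h']

theorem Learner.prob_cons {K T : ℕ} (A : Learner K) (G : Digraph (Fin K))
    (l : Fin (T + 1) → Fin K → ℝ) (a₀ : Fin K) (a : Fin T → Fin K) :
    A.prob G l (Fin.cons a₀ a) =
      A.play A.init a₀ *
        ({ A with init := A.update A.init a₀ (feedback G (l 0) a₀) } : Learner K).prob G
          (fun τ => l τ.succ) a := by
  unfold Learner.prob
  rw [Fin.prod_univ_succ]
  congr 1
  refine Finset.prod_congr rfl fun t _ => ?_
  rw [Fin.val_succ, Learner.stateAt_cons]
  rfl

theorem sum_fin_succ_fun {K T : ℕ} (f : (Fin (T + 1) → Fin K) → ℝ) :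
    ∑ a, f a = ∑ a₀ : Fin K, ∑ a : Fin T → Fin K, f (Fin.cons a₀ a) := by
  rw [← Fintype.sum_prod_type']
  exact (Fintype.sum_equiv (Fin.consEquiv fun _ : Fin (T + 1) => Fin K) _ _ fun x => rfl).symm

/-- If `B` dominates the expected instantaneous regret plus the expected next value of `B`, then
the regret is at most the initial value of `B`. -/
theorem Learner.regret_le_of_potential {K : ℕ} (G : Digraph (Fin K)) (i : Fin K) :
    ∀ (T : ℕ) (A : Learner K) (l : Fin T → Fin K → ℝ) (Inv : A.State → Prop)
      (B : ℕ → A.State → ℝ), Inv A.init →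
      (∀ s, Inv s → (∀ a, 0 ≤ A.play s a) ∧ ∑ a, A.play s a = 1) →
      (∀ (t : Fin T) s a, Inv s → Inv (A.update s a (feedback G (l t) a))) →
      (∀ (t : Fin T) s, Inv s →
        ∑ a, A.play s a * (l t a - l t i + B (t + 1) (A.update s a (feedback G (l t) a)))
          ≤ B t s) →
      (∀ s, Inv s → 0 ≤ B T s) →
      ∑ a, A.prob G l a = 1 ∧ A.regret G l i ≤ B 0 A.init := by
  intro T
  induction T with
  | zero =>
    intro A l Inv B h0 hp hs hB hT
    simp [Learner.prob, Learner.regret, totalLoss, hT _ h0]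
  | succ T ih =>
    intro A l Inv B h0 hp hs hB hT
    -- After the first arm, the learner is the same machine started from the updated state, so the
    -- induction on the horizon applies to it with losses and potential shifted by one round.
    have key := fun a₀ => ih { A with init := A.update A.init a₀ (feedback G (l 0) a₀) }
      (fun τ => l τ.succ) Inv (fun t => B (t + 1)) (hs 0 _ a₀ h0) hp
      (fun t s a h => hs t.succ s a h) (fun t s h => by simpa using hB t.succ s h) hT
    constructor
    · rw [sum_fin_succ_fun]
      simp_rw [Learner.prob_cons, ← Finset.mul_sum, (key _).1]
      simpa using (hp _ h0).2
    · unfold Learner.regret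
      rw [sum_fin_succ_fun]
      refine le_trans (Finset.sum_le_sum fun a₀ _ => ?_) (hB 0 _ h0)
      have h1 : ∀ a : Fin T → Fin K,
          A.prob G l (Fin.cons a₀ a) * (∑ t, l t ((Fin.cons a₀ a : Fin (T + 1) → Fin K) t)
            - totalLoss l i) =
          A.play A.init a₀ *
          ((l 0 a₀ - l 0 i) *
            ({ A with init := A.update A.init a₀ (feedback G (l 0) a₀) } : Learner K).prob G
              (fun τ => l τ.succ) a +
            ({ A with init := A.update A.init a₀ (feedback G (l 0) a₀) } : Learner K).prob G
              (fun τ => l τ.succ) a *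
              (∑ t : Fin T, l t.succ (a t) - totalLoss (fun τ => l τ.succ) i)) := by
        intro a
        rw [Learner.prob_cons]
        unfold totalLoss
        rw [Fin.sum_univ_succ, Fin.sum_univ_succ]
        simp only [Fin.cons_zero, Fin.cons_succ]
        ring
      simp_rw [h1]
      -- The first-round regret can be pulled out because the probabilities of the remaining rounds
      -- sum to 1; this is why total mass is proved in the same induction.
      rw [← Finset.mul_sum, Finset.sum_add_distrib, ← Finset.mul_sum, (key a₀).1, mul_one]
      exact mul_le_mul_of_nonneg_left (add_le_add le_rfl (key a₀).2) ((hp _ h0).1 a₀)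

/-! ### The independence number and the probability of observing an arm -/

/-- The probability that the loss of arm `i` is observed. -/
def obsProb {K : ℕ} (G : Digraph (Fin K)) (p : Fin K → ℝ) (i : Fin K) : ℝ :=
  ∑ j, if G.Adj j i then p j else 0

theorem card_le_independenceNumber {K : ℕ} {G : Digraph (Fin K)} {I : Finset (Fin K)}
    (h : IsIndependent G I) : I.card ≤ independenceNumber G :=
  Finset.le_sup (f := Finset.card) (by simp [h])

theorem one_le_independenceNumber {K : ℕ} (G : Digraph (Fin K)) (i : Fin K) :
    1 ≤ independenceNumber G := by
  have : IsIndependent G {i} := by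
    intro a ha b hb hab
    simp_all
  simpa using card_le_independenceNumber this

theorem independenceNumber_le {K : ℕ} (G : Digraph (Fin K)) : independenceNumber G ≤ K :=
  Finset.sup_le fun I _ => by simpa using Finset.card_le_univ I

/-- A greedy choice of an independent set: if all arms of `S` are observed with probability at
most `w` from within `S`, then `S` has mass at most `2 w α`. -/
theorem exists_independent_mass_le {K : ℕ} {G : Digraph (Fin K)} (hG : SelfAware G)
    {p : Fin K → ℝ} (hp : ∀ i, 0 < p i) {w : ℝ} (S : Finset (Fin K))
    (hS : ∀ i ∈ S, ∑ j ∈ S, (if G.Adj j i then p j else 0) ≤ w) :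
    ∃ I ⊆ S, IsIndependent G I ∧ ∑ i ∈ S, p i ≤ 2 * w * I.card := by
  induction S using Finset.strongInduction with
  | H S ih =>
    rcases S.eq_empty_or_nonempty with rfl | hne
    · exact ⟨∅, by simp, by simp [IsIndependent], by simp⟩
    -- Weighted by `p`, the out-masses and in-masses within `S` have the same sum, so some arm has
    -- out-mass at most `w` as well.
    have havg : ∃ i ∈ S, ∑ j ∈ S, (if G.Adj i j then p j else 0) ≤ w := by
      by_contra! hcon
      have h1 : ∑ i ∈ S, p i * w <
          ∑ i ∈ S, p i * ∑ j ∈ S, (if G.Adj i j then p j else 0) :=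
        Finset.sum_lt_sum_of_nonempty hne fun i hi => mul_lt_mul_of_pos_left (hcon i hi) (hp i)
      have h2 : ∑ i ∈ S, p i * ∑ j ∈ S, (if G.Adj i j then p j else 0) =
          ∑ i ∈ S, p i * ∑ j ∈ S, (if G.Adj j i then p j else 0) := by
        simp_rw [Finset.mul_sum]
        rw [Finset.sum_comm]
        refine Finset.sum_congr rfl fun i _ => Finset.sum_congr rfl fun j _ => ?_
        split_ifs <;> ring
      have h3 : ∑ i ∈ S, p i * ∑ j ∈ S, (if G.Adj j i then p j else 0) ≤ ∑ i ∈ S, p i * w :=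
        Finset.sum_le_sum fun i hi => mul_le_mul_of_nonneg_left (hS i hi) (hp i).le
      linarith
    obtain ⟨i, hi, hout⟩ := havg
    -- Taking `i` into the independent set removes its in- and out-neighbours, of mass at most `2
    -- w`: this is the mass charged to `i`.
    set S' := S.filter fun j => ¬ G.Adj i j ∧ ¬ G.Adj j i with hS'
    have hsub : S' ⊆ S := Finset.filter_subset _ _
    have hiS' : i ∉ S' := by simp [hS', hG i]
    obtain ⟨I, hI, hind, hle⟩ := ih S' ((Finset.ssubset_iff_of_subset hsub).2 ⟨i, hi, hiS'⟩)
      (fun j hj => le_trans (Finset.sum_le_sum_of_subset_of_nonneg hsub fun k _ _ => by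
        split_ifs
        · exact (hp k).le
        · exact le_rfl) (hS j (hsub hj)))
    have hiI : i ∉ I := fun h => hiS' (hI h)
    refine ⟨insert i I, Finset.insert_subset hi (hI.trans hsub), ?_, ?_⟩
    · intro a ha b hb hab
      rcases Finset.mem_insert.1 ha with rfl | ha' <;>
        rcases Finset.mem_insert.1 hb with rfl | hb'
      · exact absurd rfl hab
      · exact (Finset.mem_filter.1 (hI hb')).2.1
      · exact (Finset.mem_filter.1 (hI ha')).2.2
      · exact hind a ha' b hb' hab
    · rw [Finset.card_insert_of_notMem hiI]
      push_cast
      have h1 : ∑ j ∈ S, p j ≤ ∑ j ∈ S, ((if G.Adj i j then p j else 0) +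
          (if G.Adj j i then p j else 0) + if ¬ G.Adj i j ∧ ¬ G.Adj j i then p j else 0) := by
        refine Finset.sum_le_sum fun j _ => ?_
        have := (hp j).le
        by_cases h1 : G.Adj i j <;> by_cases h2 : G.Adj j i <;> simp [h1, h2, this]
      rw [Finset.sum_add_distrib, Finset.sum_add_distrib, ← Finset.sum_filter (s := S)
        (p := fun j => ¬ G.Adj i j ∧ ¬ G.Adj j i)] at h1
      have := hS i hi
      nlinarith

theorem le_obsProb {K : ℕ} {G : Digraph (Fin K)} (hG : SelfAware G)
    {p : Fin K → ℝ} (hp : ∀ i, 0 ≤ p i) (i : Fin K) : p i ≤ obsProb G p i := by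
  have := Finset.single_le_sum (f := fun j => if G.Adj j i then p j else 0) (s := Finset.univ)
    (fun j _ => by
      split_ifs
      exacts [hp j, le_rfl]) (Finset.mem_univ i)
  rwa [if_pos (hG i)] at this

theorem obsProb_le_one {K : ℕ} {G : Digraph (Fin K)}
    {p : Fin K → ℝ} (hp : ∀ i, 0 ≤ p i) (hp1 : ∑ i, p i = 1) (i : Fin K) :
    obsProb G p i ≤ 1 := by
  rw [← hp1]
  refine Finset.sum_le_sum fun j _ => ?_
  split_ifs
  exacts [le_rfl, hp j]

/-- The second-order term of importance weighting is of the order of the independence number. -/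
theorem sum_div_obsProb_le {K T : ℕ} {G : Digraph (Fin K)} (hG : SelfAware G) (hT : 0 < T)
    {p : Fin K → ℝ} (hp : ∀ i, 1 / (T : ℝ) ≤ p i) (hp1 : ∑ i, p i = 1) :
    ∑ i, p i / obsProb G p i ≤ 4 * independenceNumber G * (Nat.log 2 T + 1) := by
  have hT' : (0 : ℝ) < T := by exact_mod_cast hT
  have hpos : ∀ i, 0 < p i := fun i => lt_of_lt_of_le (by positivity) (hp i)
  have hp0 : ∀ i, 0 ≤ p i := fun i => (hpos i).le
  have hW : ∀ i, 0 < obsProb G p i := fun i => (hpos i).trans_le (le_obsProb hG hp0 i)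
  have hW1 : ∀ i, 1 ≤ 1 / obsProb G p i := fun i => by
    rw [le_div_iff₀ (hW i), one_mul]
    exact obsProb_le_one hp0 hp1 i
  have hWT : ∀ i, 1 / obsProb G p i ≤ T := fun i => by
    rw [div_le_iff₀ (hW i)]
    have := (hp i).trans (le_obsProb hG hp0 i)
    rwa [div_le_iff₀ hT', mul_comm] at this
  -- Dyadic level of the inverse observation probability. At level `k` the greedy set bounds the
  -- mass by `2 * 2⁻ᵏ * α`, while `1 / obsProb ≤ 2 ^ (k + 1)`, so each of the `log₂ T + 1` levels
  -- contributes at most `4 α`.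
  let f : Fin K → ℕ := fun i => Nat.log 2 ⌊1 / obsProb G p i⌋₊
  have hf0 : ∀ i, ⌊1 / obsProb G p i⌋₊ ≠ 0 := fun i => by
    have : 1 ≤ ⌊1 / obsProb G p i⌋₊ := Nat.le_floor (by simpa using hW1 i)
    omega
  have hf1 : ∀ i, (2 : ℝ) ^ f i ≤ 1 / obsProb G p i := fun i => by
    have h1 := Nat.pow_log_le_self 2 (hf0 i)
    have h2 : ((2 ^ f i : ℕ) : ℝ) ≤ (⌊1 / obsProb G p i⌋₊ : ℝ) := by exact_mod_cast h1
    push_cast at h2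
    exact h2.trans (Nat.floor_le (zero_le_one.trans (hW1 i)))
  have hf2 : ∀ i, 1 / obsProb G p i ≤ (2 : ℝ) ^ (f i + 1) := fun i => by
    have h1 := Nat.lt_pow_succ_log_self (b := 2) (by norm_num) ⌊1 / obsProb G p i⌋₊
    have h2 : (⌊1 / obsProb G p i⌋₊ : ℝ) + 1 ≤ ((2 ^ (f i + 1) : ℕ) : ℝ) := by exact_mod_cast h1
    push_cast at h2
    exact (Nat.lt_floor_add_one _).le.trans h2
  have hfT : ∀ i ∈ (Finset.univ : Finset (Fin K)), f i ∈ Finset.range (Nat.log 2 T + 1) := by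
    intro i _
    refine Finset.mem_range_succ_iff.2 (Nat.log_mono_right ?_)
    exact Nat.floor_le_of_le (hWT i)
  rw [← Finset.sum_fiberwise_of_maps_to hfT]
  have hlev : ∀ k ∈ Finset.range (Nat.log 2 T + 1),
      ∑ i ∈ Finset.univ.filter (fun i => f i = k), p i / obsProb G p i ≤
        4 * independenceNumber G := by
    intro k _
    obtain ⟨I, -, hI, hle⟩ := exists_independent_mass_le hG hpos (w := (1 / 2 : ℝ) ^ k)
      (Finset.univ.filter (fun i => f i = k)) (fun i hi => by
        have hk : f i = k := (Finset.mem_filter.1 hi).2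
        have h1 : ∑ j ∈ Finset.univ.filter (fun i => f i = k), (if G.Adj j i then p j else 0) ≤
            obsProb G p i :=
          Finset.sum_le_sum_of_subset_of_nonneg (Finset.subset_univ _) fun j _ _ => by
            split_ifs
            exacts [hp0 j, le_rfl]
        refine h1.trans ?_
        have h2 := hf1 i
        rw [hk, le_div_iff₀ (hW i)] at h2
        rw [one_div, inv_pow, ← one_div, le_div_iff₀ (by positivity)]
        linarith)
    have hc : (I.card : ℝ) ≤ independenceNumber G := by
      exact_mod_cast card_le_independenceNumber hI
    have h3 : ∑ i ∈ Finset.univ.filter (fun i => f i = k), p i / obsProb G p i ≤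
        ∑ i ∈ Finset.univ.filter (fun i => f i = k), (2 : ℝ) ^ (k + 1) * p i := by
      refine Finset.sum_le_sum fun i hi => ?_
      have hk : f i = k := (Finset.mem_filter.1 hi).2
      have := hf2 i
      rw [hk] at this
      rw [div_eq_mul_one_div, mul_comm]
      exact mul_le_mul_of_nonneg_right this (hp0 i)
    rw [← Finset.mul_sum] at h3
    refine h3.trans ?_
    calc (2 : ℝ) ^ (k + 1) * ∑ i ∈ Finset.univ.filter (fun i => f i = k), p i
        ≤ (2 : ℝ) ^ (k + 1) * (2 * (1 / 2 : ℝ) ^ k * I.card) :=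
          mul_le_mul_of_nonneg_left hle (by positivity)
      _ = 4 * (2 * (1 / 2 : ℝ)) ^ k * I.card := by
          rw [mul_pow, pow_succ]
          ring
      _ ≤ 4 * independenceNumber G := by
          norm_num
          exact_mod_cast hc
  refine (Finset.sum_le_sum hlev).trans ?_
  rw [Finset.sum_const, Finset.card_range, nsmul_eq_mul]
  push_cast
  linarith

/-! ### Online mirror descent -/

theorem argminOn_spec {K : ℕ} {f : (Fin K → ℝ) → ℝ} {Ω : Set (Fin K → ℝ)} (hΩ : IsCompact Ω)
    (hne : Ω.Nonempty) (hf : ContinuousOn f Ω) :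
    argminOn f Ω ∈ Ω ∧ IsMinOn f Ω (argminOn f Ω) :=
  Classical.epsilon_spec (p := fun p => p ∈ Ω ∧ IsMinOn f Ω p) (hΩ.exists_isMinOn hne hf)

theorem IsMinOn.fderiv_sub_nonneg {K : ℕ} {f : (Fin K → ℝ) → ℝ} {Ω : Set (Fin K → ℝ)}
    {f' : (Fin K → ℝ) →L[ℝ] ℝ} {q u : Fin K → ℝ} (hconv : Convex ℝ Ω) (hq : q ∈ Ω) (hu : u ∈ Ω)
    (hmin : IsMinOn f Ω q) (hf : HasFDerivAt f f' q) : 0 ≤ f' (u - q) :=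
  hmin.localize.hasFDerivWithinAt_nonneg hf.hasFDerivWithinAt
    (sub_mem_posTangentConeAt_of_segment_subset (hconv.segment_subset hq hu))

/-- The three-point inequality of mirror descent. -/
theorem omdStep_spec {K : ℕ} {ψ : (Fin K → ℝ) → ℝ} {Ω : Set (Fin K → ℝ)} (hΩ : IsCompact Ω)
    (hconv : Convex ℝ Ω) (hψ : ∀ q ∈ Ω, DifferentiableAt ℝ ψ q) (e p : Fin K → ℝ) {u : Fin K → ℝ}
    (hu : u ∈ Ω) :
    omdStep ψ Ω e p ∈ Ω ∧
      ∑ i, (omdStep ψ Ω e p i - u i) * e i ≤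
        bregman ψ u p - bregman ψ u (omdStep ψ Ω e p) - bregman ψ (omdStep ψ Ω e p) p := by
  let lin : (Fin K → ℝ) →L[ℝ] ℝ := ∑ i, e i • ContinuousLinearMap.proj i
  have hlin : ∀ q, lin q = ∑ i, q i * e i := fun q => by
    simp [lin, mul_comm]
  have hderiv : ∀ q ∈ Ω, HasFDerivAt (fun q => ∑ i, q i * e i + bregman ψ q p)
      (lin + (fderiv ℝ ψ q - fderiv ℝ ψ p)) q := fun q hq => by
    have h1 : HasFDerivAt (fun q => ∑ i, q i * e i) lin q := by
      simp_rw [← hlin]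
      exact lin.hasFDerivAt
    have h2 : HasFDerivAt (fun x => fderiv ℝ ψ p (x - p)) (fderiv ℝ ψ p) q := by
      simp_rw [map_sub]
      exact (fderiv ℝ ψ p).hasFDerivAt.sub_const _
    exact h1.add (((hψ q hq).hasFDerivAt.sub_const (ψ p)).sub h2)
  obtain ⟨hmem, hmin⟩ := argminOn_spec hΩ ⟨u, hu⟩
    (fun q hq => (hderiv q hq).continuousAt.continuousWithinAt)
  refine ⟨hmem, ?_⟩
  have h := IsMinOn.fderiv_sub_nonneg hconv hmem hu hmin (hderiv _ hmem)
  change 0 ≤ (lin + (fderiv ℝ ψ (omdStep ψ Ω e p) - fderiv ℝ ψ p)) (u - omdStep ψ Ω e p) at h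
  set q := omdStep ψ Ω e p
  simp only [add_apply, sub_apply, hlin, map_sub] at h
  unfold bregman
  simp only [map_sub]
  have h3 : ∑ i, (q i - u i) * e i = ∑ i, q i * e i - ∑ i, u i * e i := by
    rw [← Finset.sum_sub_distrib]
    exact Finset.sum_congr rfl fun i _ => by ring
  rw [h3]
  linarith

/-! ### Regularizers -/

theorem hasFDerivAt_sum_apply {K : ℕ} {φ : ℝ → ℝ} {φ' : Fin K → ℝ} {y : Fin K → ℝ}
    (h : ∀ i, HasDerivAt φ (φ' i) (y i)) :
    HasFDerivAt (fun p : Fin K → ℝ => ∑ i, φ (p i))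
      (∑ i, φ' i • (ContinuousLinearMap.proj i : (Fin K → ℝ) →L[ℝ] ℝ)) y :=
  HasFDerivAt.fun_sum fun i _ => (h i).comp_hasFDerivAt y (hasFDerivAt_apply i y)

theorem hasFDerivAt_entropyReg {K : ℕ} (η : ℝ) {y : Fin K → ℝ} (hy : ∀ i, 0 < y i) :
    HasFDerivAt (entropyReg η) ((1 / η) •
      ∑ i, (Real.log (y i) + 1) • (ContinuousLinearMap.proj i : (Fin K → ℝ) →L[ℝ] ℝ)) y :=
  (hasFDerivAt_sum_apply fun i => Real.hasDerivAt_mul_log (hy i).ne').const_mul (1 / η)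

theorem hasFDerivAt_sum_log_one_div {K : ℕ} {y : Fin K → ℝ} (hy : ∀ i, 0 < y i) :
    HasFDerivAt (fun p : Fin K → ℝ => ∑ i, Real.log (1 / p i))
      (∑ i, (-(y i)⁻¹) • (ContinuousLinearMap.proj i : (Fin K → ℝ) →L[ℝ] ℝ)) y := by
  refine hasFDerivAt_sum_apply (φ := fun x => Real.log (1 / x)) fun i => ?_
  simp_rw [one_div, Real.log_inv]
  exact (Real.hasDerivAt_log (hy i).ne').neg

theorem hasFDerivAt_hybridReg {K : ℕ} (η c : ℝ) {y : Fin K → ℝ} (hy : ∀ i, 0 < y i) :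
    HasFDerivAt (hybridReg η c) ((1 / η) •
      ∑ i, (Real.log (y i) + 1) • (ContinuousLinearMap.proj i : (Fin K → ℝ) →L[ℝ] ℝ) +
      c • ∑ i, (-(y i)⁻¹) • (ContinuousLinearMap.proj i : (Fin K → ℝ) →L[ℝ] ℝ)) y :=
  (hasFDerivAt_entropyReg η hy).add ((hasFDerivAt_sum_log_one_div hy).const_mul c)

theorem bregman_entropyReg {K : ℕ} (η : ℝ) (x : Fin K → ℝ) {y : Fin K → ℝ}
    (hy : ∀ i, 0 < y i) :
    bregman (entropyReg η) x y =
      1 / η * ∑ i, (x i * (Real.log (x i) - Real.log (y i)) - x i + y i) := by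
  unfold bregman
  rw [(hasFDerivAt_entropyReg η hy).fderiv]
  simp only [smul_apply, sum_apply,
    ContinuousLinearMap.proj_apply, Pi.sub_apply, smul_eq_mul, entropyReg]
  rw [← mul_sub, ← mul_sub, ← Finset.sum_sub_distrib, ← Finset.sum_sub_distrib]
  congr 1
  exact Finset.sum_congr rfl fun i _ => by ring

/-- Reduces each coordinate of the unnormalized relative entropy to `klFun`, whose sign and unique
zero are known. The case `x = 0` is included because iterates on the full simplex may a priori lie
on its boundary. -/
theorem mul_log_sub_log_eq_klFun {x z : ℝ} (hx : 0 ≤ x) (hz : 0 < z) :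
    x * (Real.log x - Real.log z) - x + z = z * InformationTheory.klFun (x / z) := by
  rcases hx.eq_or_lt with rfl | hx
  · simp [InformationTheory.klFun]
  · rw [InformationTheory.klFun, Real.log_div hx.ne' hz.ne']
    field_simp
    ring

theorem mul_log_sub_log_nonneg {x z : ℝ} (hx : 0 ≤ x) (hz : 0 < z) :
    0 ≤ x * (Real.log x - Real.log z) - x + z := by
  rw [mul_log_sub_log_eq_klFun hx hz]
  exact mul_nonneg hz.le (InformationTheory.klFun_nonneg (by positivity))

theorem eq_of_mul_log_sub_log_eq_zero {x z : ℝ} (hx : 0 ≤ x) (hz : 0 < z)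
    (h : x * (Real.log x - Real.log z) - x + z = 0) : x = z := by
  rw [mul_log_sub_log_eq_klFun hx hz] at h
  have := (InformationTheory.klFun_eq_zero_iff (by positivity)).1
    ((mul_eq_zero.1 h).resolve_left hz.ne')
  rwa [div_eq_one_iff_eq hz.ne'] at this

/-- The log-barrier is convex and only adds a nonnegative divergence, so the stability of the second
stage can be read off the entropy part alone. -/
theorem bregman_entropyReg_le_bregman_hybridReg {K : ℕ} (η : ℝ) {c : ℝ} (hc : 0 ≤ c)
    {x y : Fin K → ℝ} (hx : ∀ i, 0 < x i) (hy : ∀ i, 0 < y i) :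
    bregman (entropyReg η) x y ≤ bregman (hybridReg η c) x y := by
  unfold bregman
  rw [(hasFDerivAt_entropyReg η hy).fderiv, (hasFDerivAt_hybridReg η c hy).fderiv]
  simp only [add_apply, smul_apply, smul_eq_mul,
    sum_apply, ContinuousLinearMap.proj_apply, Pi.sub_apply]
  have h : 0 ≤ c * (∑ i, Real.log (1 / x i) - ∑ i, Real.log (1 / y i) -
      ∑ i, -(y i)⁻¹ * (x i - y i)) := by
    refine mul_nonneg hc ?_
    rw [← Finset.sum_sub_distrib, ← Finset.sum_sub_distrib]
    refine Finset.sum_nonneg fun i _ => ?_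
    have h1 := Real.log_le_sub_one_of_pos (div_pos (hx i) (hy i))
    rw [Real.log_div (hx i).ne' (hy i).ne'] at h1
    rw [one_div, one_div, Real.log_inv, Real.log_inv]
    have h2 : -(y i)⁻¹ * (x i - y i) = 1 - x i / y i := by
      have := (hy i).ne'
      field_simp
      ring
    rw [h2]
    linarith
  unfold hybridReg entropyReg
  linarith

theorem exp_neg_le_quadratic {x : ℝ} (hx : 0 ≤ x) : Real.exp (-x) ≤ 1 - x + x ^ 2 / 2 := by
  have h1 := Real.quadratic_le_exp_of_nonneg hx
  have h2 : 0 < 1 + x + x ^ 2 / 2 := by positivity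
  rw [Real.exp_neg]
  calc (Real.exp x)⁻¹ ≤ (1 + x + x ^ 2 / 2)⁻¹ := inv_anti₀ h2 h1
    _ ≤ 1 - x + x ^ 2 / 2 := by
      rw [inv_le_iff_one_le_mul₀ h2]
      -- The product of the two quadratics is `1 + x ^ 4 / 4`.
      nlinarith [sq_nonneg (x ^ 2)]

/-- The local-norm bound on the stability of entropic mirror descent. -/
theorem sum_sub_mul_sub_bregman_le {K : ℕ} {η : ℝ} (hη : 0 < η) {p q e : Fin K → ℝ}
    (hp : ∀ i, 0 < p i) (hq : ∀ i, 0 ≤ q i) (he : ∀ i, 0 ≤ e i) :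
    ∑ i, (p i - q i) * e i - bregman (entropyReg η) q p ≤ η / 2 * ∑ i, p i * e i ^ 2 := by
  rw [bregman_entropyReg η q hp, Finset.mul_sum, Finset.mul_sum, ← Finset.sum_sub_distrib]
  refine Finset.sum_le_sum fun i _ => ?_
  -- `p i * exp (-η e i)` is the unconstrained maximizer in `q i` of the summand; nonnegativity of
  -- the relative entropy to it gives the maximum, which the quadratic bound on `exp` then
  -- estimates.
  have hz : 0 < p i * Real.exp (-(η * e i)) := mul_pos (hp i) (Real.exp_pos _)
  have h1 := mul_log_sub_log_nonneg (hq i) hz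
  rw [Real.log_mul (hp i).ne' (Real.exp_pos _).ne', Real.log_exp] at h1
  have h2 := mul_le_mul_of_nonneg_left
    (exp_neg_le_quadratic (mul_nonneg hη.le (he i))) (hp i).le
  rw [sub_le_iff_le_add, ← sub_le_iff_le_add', one_div, ← div_eq_inv_mul, le_div_iff₀ hη]
  nlinarith

/-! ### The exponential weights distribution -/

/-- The distribution with weights proportional to `exp (-η L i)`. -/
def softmax {K : ℕ} (η : ℝ) (L : Fin K → ℝ) (i : Fin K) : ℝ :=
  Real.exp (-(η * L i)) / ∑ j, Real.exp (-(η * L j))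

theorem sum_exp_pos {K : ℕ} (η : ℝ) (L : Fin K → ℝ) {S : Finset (Fin K)} (hS : S.Nonempty) :
    0 < ∑ j ∈ S, Real.exp (-(η * L j)) :=
  Finset.sum_pos (fun _ _ => Real.exp_pos _) hS

theorem softmax_pos {K : ℕ} (η : ℝ) (L : Fin K → ℝ) (i : Fin K) : 0 < softmax η L i :=
  div_pos (Real.exp_pos _) (sum_exp_pos η L ⟨i, Finset.mem_univ i⟩)

theorem sum_softmax {K : ℕ} (η : ℝ) (L : Fin K → ℝ) (i : Fin K) : ∑ j, softmax η L j = 1 := by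
  unfold softmax
  rw [← Finset.sum_div]
  exact div_self (sum_exp_pos η L ⟨i, Finset.mem_univ i⟩).ne'

theorem softmax_zero {K : ℕ} (η : ℝ) : softmax η (0 : Fin K → ℝ) = uniform K := by
  ext i
  simp [softmax, uniform]

theorem log_softmax {K : ℕ} (η : ℝ) (L : Fin K → ℝ) (i : Fin K) :
    Real.log (softmax η L i) = -(η * L i) - Real.log (∑ j, Real.exp (-(η * L j))) := by
  unfold softmax
  rw [Real.log_div (Real.exp_pos _).ne' (sum_exp_pos η L ⟨i, Finset.mem_univ i⟩).ne',
    Real.log_exp]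

/-- Entropic mirror descent on the simplex is the exponential weights algorithm. -/
theorem omdStep_softmax {K : ℕ} (i₀ : Fin K) {η : ℝ} (hη : 0 < η) (e L : Fin K → ℝ) :
    omdStep (entropyReg η) (stdSimplex ℝ (Fin K)) e (softmax η L) = softmax η (L + e) := by
  set z := softmax η (L + e)
  have hz : ∀ i, 0 < z i := softmax_pos _ _
  have hz1 : ∑ i, z i = 1 := sum_softmax _ _ i₀
  -- On the simplex the objective is the relative entropy to `z`, scaled by `1 / η`, plus a
  -- constant. This replaces first-order conditions, which are unavailable at the boundary where the
  -- entropy is not differentiable.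
  have hobj : ∀ q ∈ stdSimplex ℝ (Fin K),
      ∑ i, q i * e i + bregman (entropyReg η) q (softmax η L) =
        1 / η * ∑ i, (q i * (Real.log (q i) - Real.log (z i)) - q i + z i) +
        1 / η * (Real.log (∑ j, Real.exp (-(η * L j))) -
          Real.log (∑ j, Real.exp (-(η * (L + e) j)))) := by
    intro q hq
    rw [bregman_entropyReg η q (softmax_pos _ _)]
    simp only [z, log_softmax]
    set a := Real.log (∑ j, Real.exp (-(η * L j)))
    set b := Real.log (∑ j, Real.exp (-(η * (L + e) j)))
    have h1 : ∑ i, (q i * (Real.log (q i) - (-(η * L i) - a)) - q i + softmax η L i) =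
        ∑ i, (q i * Real.log (q i) + η * (q i * L i)) + a := by
      have : ∀ i, q i * (Real.log (q i) - (-(η * L i) - a)) - q i + softmax η L i =
        (q i * Real.log (q i) + η * (q i * L i)) + a * q i - q i + softmax η L i := fun i => by ring
      simp_rw [this]
      rw [Finset.sum_add_distrib, Finset.sum_sub_distrib, Finset.sum_add_distrib,
        ← Finset.mul_sum, hq.2, sum_softmax _ _ i₀]
      ring
    have h2 : ∑ i, (q i * (Real.log (q i) - (-(η * (L + e) i) - b)) - q i + softmax η (L + e) i) =
        ∑ i, (q i * Real.log (q i) + η * (q i * L i)) + η * ∑ i, q i * e i + b := by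
      have : ∀ i, q i * (Real.log (q i) - (-(η * (L + e) i) - b)) - q i + softmax η (L + e) i =
        (q i * Real.log (q i) + η * (q i * L i)) + η * (q i * e i) + b * q i - q i
          + softmax η (L + e) i := fun i => by
        simp only [Pi.add_apply]
        ring
      simp_rw [this]
      rw [Finset.sum_add_distrib, Finset.sum_sub_distrib, Finset.sum_add_distrib,
        Finset.sum_add_distrib,
        ← Finset.mul_sum, ← Finset.mul_sum, hq.2, sum_softmax _ _ i₀]
      ring
    rw [h1, h2]
    field_simp
    ring
  have hzmem : z ∈ stdSimplex ℝ (Fin K) := ⟨fun i => (hz i).le, hz1⟩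
  have hkl : ∀ q ∈ stdSimplex ℝ (Fin K), ∀ i ∈ Finset.univ,
      0 ≤ q i * (Real.log (q i) - Real.log (z i)) - q i + z i := fun q hq i _ =>
    mul_log_sub_log_nonneg (hq.1 i) (hz i)
  have hex : ∃ q, q ∈ stdSimplex ℝ (Fin K) ∧
      IsMinOn (fun q => ∑ i, q i * e i + bregman (entropyReg η) q (softmax η L))
        (stdSimplex ℝ (Fin K)) q := by
    refine ⟨z, hzmem, fun q hq => ?_⟩
    simp only [Set.mem_ofPred_eq]
    rw [hobj q hq, hobj z hzmem]
    have h0 : ∑ i, (z i * (Real.log (z i) - Real.log (z i)) - z i + z i) = 0 := by simp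
    rw [h0]
    have := Finset.sum_nonneg (hkl q hq)
    have h2 : 0 ≤ 1 / η * ∑ i, (q i * (Real.log (q i) - Real.log (z i)) - q i + z i) := by
      positivity
    linarith
  obtain ⟨hmem, hmin⟩ := Classical.epsilon_spec hex
  change omdStep (entropyReg η) (stdSimplex ℝ (Fin K)) e (softmax η L) ∈ _ at hmem
  change IsMinOn _ _ (omdStep (entropyReg η) (stdSimplex ℝ (Fin K)) e (softmax η L)) at hmin
  set q := omdStep (entropyReg η) (stdSimplex ℝ (Fin K)) e (softmax η L)
  have h1 := hmin hzmem
  simp only [Set.mem_ofPred_eq] at h1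
  rw [hobj q hmem, hobj z hzmem] at h1
  have h0 : ∑ i, (z i * (Real.log (z i) - Real.log (z i)) - z i + z i) = 0 := by simp
  rw [h0, mul_zero] at h1
  have h2 := Finset.sum_nonneg (hkl q hmem)
  have h3 : ∑ i, (q i * (Real.log (q i) - Real.log (z i)) - q i + z i) = 0 := by
    refine le_antisymm ?_ h2
    by_contra! hcon
    have : 0 < 1 / η * ∑ i, (q i * (Real.log (q i) - Real.log (z i)) - q i + z i) := by
      positivity
    linarith
  ext i
  exact eq_of_mul_log_sub_log_eq_zero (hmem.1 i) (hz i)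
    ((Finset.sum_eq_zero_iff_of_nonneg (hkl q hmem)).1 h3 i (Finset.mem_univ i))

/-! ### The loss estimator -/

theorem estimator_feedback {K : ℕ} (G : Digraph (Fin K)) (p l : Fin K → ℝ) (a i : Fin K) :
    estimator G p (feedback G l a) i = if G.Adj a i then l i / obsProb G p i else 0 := by
  unfold estimator feedback obsProb
  by_cases h : G.Adj a i <;> simp [h]

theorem estimator_feedback_nonneg {K : ℕ} {G : Digraph (Fin K)} {p l : Fin K → ℝ}
    (hp : ∀ i, 0 ≤ p i) (hl : ∀ i, 0 ≤ l i) (a i : Fin K) :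
    0 ≤ estimator G p (feedback G l a) i := by
  rw [estimator_feedback]
  split_ifs
  · refine div_nonneg (hl i) (Finset.sum_nonneg fun j _ => ?_)
    split_ifs
    exacts [hp j, le_rfl]
  · exact le_rfl

theorem sum_mul_estimator {K : ℕ} {G : Digraph (Fin K)} {p : Fin K → ℝ} (l : Fin K → ℝ)
    {i : Fin K} (hW : 0 < obsProb G p i) :
    ∑ a, p a * estimator G p (feedback G l a) i = l i := by
  have : ∀ a, p a * estimator G p (feedback G l a) i =
      (if G.Adj a i then p a else 0) * (l i / obsProb G p i) := fun a => by
    rw [estimator_feedback]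
    split_ifs <;> ring
  simp_rw [this]
  rw [← Finset.sum_mul]
  exact mul_div_cancel₀ _ hW.ne'

theorem sum_mul_estimator_sq_le {K : ℕ} {G : Digraph (Fin K)} {p : Fin K → ℝ} {l : Fin K → ℝ}
    (hl : ∀ i, l i ∈ Set.Icc (0 : ℝ) 1) {i : Fin K} (hW : 0 < obsProb G p i) :
    ∑ a, p a * estimator G p (feedback G l a) i ^ 2 ≤ 1 / obsProb G p i := by
  have : ∀ a, p a * estimator G p (feedback G l a) i ^ 2 =
      (if G.Adj a i then p a else 0) * (l i / obsProb G p i) ^ 2 := fun a => by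
    rw [estimator_feedback]
    split_ifs <;> ring
  simp_rw [this]
  rw [← Finset.sum_mul]
  change obsProb G p i * _ ≤ _
  have h1 : obsProb G p i * (l i / obsProb G p i) ^ 2 = l i ^ 2 / obsProb G p i := by
    field_simp
  rw [h1]
  have h2 : l i ^ 2 ≤ 1 := pow_le_one₀ (hl i).1 (hl i).2
  gcongr

/-! ### The second stage -/

theorem isCompact_clippedSimplex (K T : ℕ) : IsCompact (clippedSimplex K T) := by
  refine (isCompact_stdSimplex ℝ (Fin K)).inter_right (t := {p | ∀ i, 1 / (T : ℝ) ≤ p i}) ?_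
  rw [Set.ofPred_forall]
  exact isClosed_iInter fun i => isClosed_le continuous_const (continuous_apply i)

theorem convex_clippedSimplex (K T : ℕ) : Convex ℝ (clippedSimplex K T) := by
  intro x hx y hy a b ha hb hab
  refine ⟨convex_stdSimplex ℝ (Fin K) hx.1 hy.1 ha hb hab, fun i => ?_⟩
  have h1 := mul_le_mul_of_nonneg_left (hx.2 i) ha
  have h2 := mul_le_mul_of_nonneg_left (hy.2 i) hb
  simp only [Pi.add_apply, Pi.smul_apply, smul_eq_mul]
  calc 1 / (T : ℝ) = a * (1 / T) + b * (1 / T) := by rw [← add_mul, hab, one_mul]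
    _ ≤ _ := add_le_add h1 h2

/-- The vertex `i₀` of the simplex, moved to the clipped simplex. -/
def comparator {K : ℕ} (T : ℕ) (i₀ : Fin K) (i : Fin K) : ℝ :=
  1 / (T : ℝ) + if i = i₀ then 1 - (K : ℝ) / T else 0

theorem comparator_mem {K T : ℕ} (hT : 0 < T) (hKT : K ≤ T) (i₀ : Fin K) :
    comparator T i₀ ∈ clippedSimplex K T := by
  have hT' : (0 : ℝ) < T := by exact_mod_cast hT
  have hle : (K : ℝ) / T ≤ 1 := by
    rw [div_le_one hT']
    exact_mod_cast hKT
  have h0 : ∀ i : Fin K, 1 / (T : ℝ) ≤ comparator T i₀ i := fun i => by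
    unfold comparator
    split_ifs <;> linarith
  refine ⟨⟨fun i => le_trans (by positivity) (h0 i), ?_⟩, h0⟩
  unfold comparator
  rw [Finset.sum_add_distrib]
  simp
  field_simp
  ring

/-- The clipped comparator costs at most `K / T` more than the vertex per round, hence at most `K`
in total. -/
theorem sum_comparator_mul_le {K T : ℕ} (i₀ : Fin K) {l : Fin K → ℝ}
    (hl : ∀ i, l i ∈ Set.Icc (0 : ℝ) 1) :
    ∑ i, comparator T i₀ i * l i ≤ l i₀ + K / T := by
  unfold comparator
  simp_rw [add_mul, ite_mul, zero_mul]
  rw [Finset.sum_add_distrib, Finset.sum_ite_eq' Finset.univ i₀, if_pos (Finset.mem_univ _),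
    ← Finset.mul_sum]
  have h1 : ∑ i, l i ≤ (K : ℝ) := by
    have := Finset.sum_le_sum (s := Finset.univ) fun (i : Fin K) _ => (hl i).2
    simpa using this
  have h2 : 1 / (T : ℝ) * ∑ i, l i ≤ 1 / (T : ℝ) * K :=
    mul_le_mul_of_nonneg_left h1 (by positivity)
  have h3 : 0 ≤ (K : ℝ) / T * l i₀ := mul_nonneg (by positivity) (hl i₀).1
  have h4 : 1 / (T : ℝ) * K = K / T := by ring
  nlinarith

section

variable {K T : ℕ} {G : Digraph (Fin K)}

theorem pos_of_mem_clippedSimplex (hT : 0 < T) {p : Fin K → ℝ} (hp : p ∈ clippedSimplex K T)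
    (i : Fin K) : 0 < p i :=
  lt_of_lt_of_le (by positivity) (hp.2 i)

theorem rate2_pos (hT : 0 < T) (i₀ : Fin K) : 0 < rate2 T G := by
  have h1 : (0 : ℝ) < independenceNumber G := by exact_mod_cast one_le_independenceNumber G i₀
  have h2 : (0 : ℝ) < T := by exact_mod_cast hT
  unfold rate2
  positivity

theorem differentiableAt_reg2 (hT : 0 < T) {q : Fin K → ℝ} (hq : q ∈ clippedSimplex K T) :
    DifferentiableAt ℝ (reg2 T G) q :=
  (hasFDerivAt_hybridReg _ _ (pos_of_mem_clippedSimplex hT hq)).differentiableAt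

theorem bregman_reg2_nonneg (hT : 0 < T) {x y : Fin K → ℝ} (hx : x ∈ clippedSimplex K T)
    (hy : y ∈ clippedSimplex K T) : 0 ≤ bregman (reg2 T G) x y := by
  have hx' := pos_of_mem_clippedSimplex hT hx
  have hy' := pos_of_mem_clippedSimplex hT hy
  refine le_trans ?_ (bregman_entropyReg_le_bregman_hybridReg _ (by positivity) hx' hy')
  rw [bregman_entropyReg _ _ hy']
  exact mul_nonneg (by unfold rate2; positivity)
    (Finset.sum_nonneg fun i _ => mul_log_sub_log_nonneg (hx' i).le (hy' i))

theorem argminOn_reg2_spec (hT : 0 < T) (hKT : K ≤ T) (i₀ : Fin K) :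
    argminOn (reg2 T G) (clippedSimplex K T) ∈ clippedSimplex K T ∧
      IsMinOn (reg2 T G) (clippedSimplex K T) (argminOn (reg2 T G) (clippedSimplex K T)) :=
  argminOn_spec (isCompact_clippedSimplex K T) ⟨_, comparator_mem hT hKT i₀⟩
    fun _ hq => (differentiableAt_reg2 hT hq).continuousAt.continuousWithinAt

/-- Starting from the minimizer makes the first-order term nonnegative, so the initial divergence is
at most the range of the regularizer: `√(αT) log T` from the entropy and `64 K * K log T` from the
barrier, using that all coordinates are at least `1 / T`. -/
theorem bregman_reg2_argminOn_le (hT : 0 < T) (hKT : K ≤ T) (i₀ : Fin K) {u : Fin K → ℝ}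
    (hu : u ∈ clippedSimplex K T) :
    bregman (reg2 T G) u (argminOn (reg2 T G) (clippedSimplex K T)) ≤
      √((independenceNumber G : ℝ) * T) * Real.log T + 64 * K ^ 2 * Real.log T := by
  obtain ⟨hmem, hmin⟩ := argminOn_reg2_spec (G := G) hT hKT i₀
  set p := argminOn (reg2 T G) (clippedSimplex K T)
  have hT' : (0 : ℝ) < T := by exact_mod_cast hT
  have h1 := IsMinOn.fderiv_sub_nonneg (convex_clippedSimplex K T) hmem hu hmin
    (differentiableAt_reg2 hT hmem).hasFDerivAt
  have hu0 := pos_of_mem_clippedSimplex hT hu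
  have hp0 := pos_of_mem_clippedSimplex hT hmem
  have hle1 : ∀ q ∈ clippedSimplex K T, ∀ i, q i ≤ 1 := fun q hq i =>
    hq.1.2 ▸ Finset.single_le_sum (fun j _ => hq.1.1 j) (Finset.mem_univ i)
  have hlogu : ∀ q ∈ clippedSimplex K T, ∀ i, -Real.log T ≤ Real.log (q i) := fun q hq i => by
    rw [← Real.log_inv, ← one_div]
    exact Real.log_le_log (by positivity) (hq.2 i)
  have hr : 1 / rate2 T G = √((independenceNumber G : ℝ) * T) := by
    unfold rate2
    rw [one_div_one_div]
  have hup : reg2 T G u ≤ 64 * K ^ 2 * Real.log T := by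
    unfold reg2 hybridReg
    rw [hr]
    have h2 : ∑ i, u i * Real.log (u i) ≤ 0 := Finset.sum_nonpos fun i _ =>
      mul_nonpos_of_nonneg_of_nonpos (hu0 i).le (Real.log_nonpos (hu0 i).le (hle1 u hu i))
    have h3 : ∑ i, Real.log (1 / u i) ≤ K * Real.log T := by
      have := Finset.sum_le_card_nsmul Finset.univ (fun i => Real.log (1 / u i)) (Real.log T)
        fun i _ => by
          rw [one_div, Real.log_inv]
          linarith [hlogu u hu i]
      simpa using this
    have h4 := mul_nonpos_of_nonneg_of_nonpos
      (Real.sqrt_nonneg ((independenceNumber G : ℝ) * T)) h2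
    have h5 := mul_le_mul_of_nonneg_left h3 (by positivity : (0 : ℝ) ≤ 64 * K)
    nlinarith
  have hlow : -(√((independenceNumber G : ℝ) * T) * Real.log T) ≤ reg2 T G p := by
    unfold reg2 hybridReg
    rw [hr]
    have h2 : -Real.log T ≤ ∑ i, p i * Real.log (p i) := by
      have := Finset.sum_le_sum (s := Finset.univ) fun (i : Fin K) _ =>
        mul_le_mul_of_nonneg_left (hlogu p hmem i) (hp0 i).le
      rwa [← Finset.sum_mul, hmem.1.2, one_mul] at this
    have h3 : 0 ≤ ∑ i, Real.log (1 / p i) := Finset.sum_nonneg fun i _ => by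
      rw [one_div, Real.log_inv, neg_nonneg]
      exact Real.log_nonpos (hp0 i).le (hle1 p hmem i)
    have h4 := mul_le_mul_of_nonneg_left h2
      (Real.sqrt_nonneg ((independenceNumber G : ℝ) * T))
    have h5 : 0 ≤ 64 * (K : ℝ) * ∑ i, Real.log (1 / p i) := by positivity
    linarith
  unfold bregman
  linarith

/-- One round of the second stage. -/
theorem exploit_step (hG : SelfAware G) (hT : 0 < T) (i₀ : Fin K) {u p l : Fin K → ℝ}
    (hu : u ∈ clippedSimplex K T) (hp : p ∈ clippedSimplex K T)
    (hl : ∀ i, l i ∈ Set.Icc (0 : ℝ) 1) :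
    ∑ a, p a * (l a - ∑ i, u i * l i + bregman (reg2 T G) u
        (omdStep (reg2 T G) (clippedSimplex K T) (estimator G p (feedback G l a)) p)) ≤
      bregman (reg2 T G) u p +
        rate2 T G * (2 * independenceNumber G * (Nat.log 2 T + 1)) := by
  have hp0 := pos_of_mem_clippedSimplex hT hp
  have hW : ∀ i, 0 < obsProb G p i := fun i =>
    (hp0 i).trans_le (le_obsProb hG (fun i => (hp0 i).le) i)
  have hη := rate2_pos (G := G) hT i₀
  set η := rate2 T G
  set e : Fin K → Fin K → ℝ := fun a => estimator G p (feedback G l a)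
  have he : ∀ a i, 0 ≤ e a i := fun a i =>
    estimator_feedback_nonneg (fun i => (hp0 i).le) (fun i => (hl i).1) a i
  have hstep : ∀ a, bregman (reg2 T G) u (omdStep (reg2 T G) (clippedSimplex K T) (e a) p) ≤
      bregman (reg2 T G) u p - ∑ i, (p i - u i) * e a i + η / 2 * ∑ i, p i * e a i ^ 2 := by
    intro a
    obtain ⟨h1, h2⟩ := omdStep_spec (isCompact_clippedSimplex K T) (convex_clippedSimplex K T)
      (fun q hq => differentiableAt_reg2 (G := G) hT hq) (e a) p hu
    set q := omdStep (reg2 T G) (clippedSimplex K T) (e a) p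
    have hq0 := pos_of_mem_clippedSimplex hT h1
    have h3 := sum_sub_mul_sub_bregman_le hη hp0 (fun i => (hq0 i).le) (he a)
    have h4 := bregman_entropyReg_le_bregman_hybridReg η
      (by positivity : (0 : ℝ) ≤ 64 * K) hq0 hp0
    change _ ≤ bregman (reg2 T G) q p at h4
    have h5 : ∑ i, (p i - u i) * e a i =
        -- Splitting at the new iterate `q`: the second sum is handled by the three-point
        -- inequality, whose negative divergence term absorbs the first sum up to the local norm.
        ∑ i, (p i - q i) * e a i + ∑ i, (q i - u i) * e a i := by
      rw [← Finset.sum_add_distrib]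
      exact Finset.sum_congr rfl fun i _ => by ring
    linarith
  have hlin : ∑ a, p a * ∑ i, (p i - u i) * e a i = ∑ i, (p i - u i) * l i := by
    simp_rw [Finset.mul_sum]
    rw [Finset.sum_comm]
    refine Finset.sum_congr rfl fun i _ => ?_
    rw [← sum_mul_estimator l (hW i), Finset.mul_sum]
    exact Finset.sum_congr rfl fun a _ => by simp only [e]; ring
  have hquad : ∑ a, p a * ∑ i, p i * e a i ^ 2 ≤
      4 * independenceNumber G * (Nat.log 2 T + 1) := by
    refine le_trans ?_ (sum_div_obsProb_le hG hT hp.2 hp.1.2)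
    simp_rw [Finset.mul_sum]
    rw [Finset.sum_comm]
    refine Finset.sum_le_sum fun i _ => ?_
    have h1 := mul_le_mul_of_nonneg_left (sum_mul_estimator_sq_le hl (hW i)) (hp0 i).le
    rw [Finset.mul_sum, mul_one_div] at h1
    refine le_trans (le_of_eq (Finset.sum_congr rfl fun a _ => ?_)) h1
    simp only [e]
    ring
  have hsum := Finset.sum_le_sum (s := Finset.univ) fun (a : Fin K) _ =>
    mul_le_mul_of_nonneg_left (add_le_add (le_refl (l a - ∑ i, u i * l i)) (hstep a)) (hp0 a).le
  refine hsum.trans ?_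
  have hexp : ∀ a, p a * (l a - ∑ i, u i * l i + (bregman (reg2 T G) u p -
      ∑ i, (p i - u i) * e a i + η / 2 * ∑ i, p i * e a i ^ 2)) =
      p a * l a + p a * (bregman (reg2 T G) u p - ∑ i, u i * l i) -
      p a * ∑ i, (p i - u i) * e a i + η / 2 * (p a * ∑ i, p i * e a i ^ 2) := fun a => by ring
  simp_rw [hexp]
  rw [Finset.sum_add_distrib, Finset.sum_sub_distrib, Finset.sum_add_distrib, hlin,
    ← Finset.sum_mul, hp.1.2, ← Finset.mul_sum]
  have h6 : ∑ i, (p i - u i) * l i = ∑ i, p i * l i - ∑ i, u i * l i := by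
    rw [← Finset.sum_sub_distrib]
    exact Finset.sum_congr rfl fun i _ => by ring
  have h7 := mul_le_mul_of_nonneg_left hquad (by positivity : 0 ≤ η / 2)
  rw [h6]
  linarith

end

/-! ### The exponential weights potential -/

/-- The soft minimum of the cumulative losses of the arms of `S`. -/
def softMin {K : ℕ} (η : ℝ) (S : Finset (Fin K)) (L : Fin K → ℝ) : ℝ :=
  -(1 / η * Real.log (∑ i ∈ S, Real.exp (-(η * L i))))

/-- The soft minimum over `S`, capped at a distance from the soft minimum over all arms. -/
def cappedSoftMin {K : ℕ} (c η : ℝ) (S : Finset (Fin K)) (L : Fin K → ℝ) : ℝ :=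
  min (softMin η S L) (softMin η Finset.univ L + c / η)

section

variable {K : ℕ} {η : ℝ} {S : Finset (Fin K)} {L L' : Fin K → ℝ}

theorem softMin_mono (hη : 0 < η) (hS : S.Nonempty) (h : ∀ i ∈ S, L i ≤ L' i) :
    softMin η S L ≤ softMin η S L' := by
  unfold softMin
  refine neg_le_neg (mul_le_mul_of_nonneg_left (Real.log_le_log (sum_exp_pos _ _ hS) ?_)
    (by positivity))
  exact Finset.sum_le_sum fun i hi =>
    Real.exp_le_exp.2 (neg_le_neg (mul_le_mul_of_nonneg_left (h i hi) hη.le))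

theorem softMin_le (hη : 0 < η) {i : Fin K} (hi : i ∈ S) : softMin η S L ≤ L i := by
  have h1 : Real.exp (-(η * L i)) ≤ ∑ i ∈ S, Real.exp (-(η * L i)) :=
    Finset.single_le_sum (f := fun i => Real.exp (-(η * L i)))
      (fun j _ => (Real.exp_pos _).le) hi
  have h2 := Real.log_le_log (Real.exp_pos _) h1
  rw [Real.log_exp] at h2
  unfold softMin
  rw [neg_le, one_div, ← div_eq_inv_mul, le_div_iff₀ hη]
  linarith

theorem softMin_add_le (hη : 0 < η) (hS : S.Nonempty) {e : Fin K → ℝ} {b : ℝ}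
    (he : ∀ i ∈ S, e i ≤ b) : softMin η S (L + e) ≤ softMin η S L + b := by
  have h1 : Real.exp (-(η * b)) * ∑ i ∈ S, Real.exp (-(η * L i)) ≤
      ∑ i ∈ S, Real.exp (-(η * (L + e) i)) := by
    rw [Finset.mul_sum]
    refine Finset.sum_le_sum fun i hi => ?_
    rw [← Real.exp_add, Real.exp_le_exp, Pi.add_apply]
    have := mul_le_mul_of_nonneg_left (he i hi) hη.le
    linarith
  have h0 := sum_exp_pos η L hS
  have h2 := Real.log_le_log (mul_pos (Real.exp_pos _) h0) h1
  rw [Real.log_mul (Real.exp_pos _).ne' h0.ne', Real.log_exp] at h2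
  have h3 := mul_le_mul_of_nonneg_left h2 (by positivity : 0 ≤ 1 / η)
  have h4 : 1 / η * (-(η * b)) = -b := by field_simp
  unfold softMin
  rw [mul_add, h4] at h3
  linarith

theorem neg_log_div_le_softMin (hη : 0 < η) (hS : S.Nonempty) (hL : ∀ i, 0 ≤ L i) :
    -(Real.log K / η) ≤ softMin η S L := by
  have h1 : ∑ i ∈ S, Real.exp (-(η * L i)) ≤ K := by
    calc ∑ i ∈ S, Real.exp (-(η * L i)) ≤ ∑ i ∈ S, (1 : ℝ) :=
          Finset.sum_le_sum fun i _ => Real.exp_le_one_iff.2 (by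
            have := mul_nonneg hη.le (hL i)
            linarith)
      _ ≤ K := by
          have := Finset.card_le_univ S
          simpa using this
  have h2 := Real.log_le_log (sum_exp_pos η L hS) h1
  unfold softMin
  rw [neg_le_neg_iff, one_div, ← div_eq_inv_mul]
  gcongr

/-- One step of exponential weights on `S`. -/
theorem sum_sub_le_softMin_sub (hη : 0 < η) (hS : S.Nonempty) {e : Fin K → ℝ}
    (he : ∀ i ∈ S, 0 ≤ e i) :
    ∑ i ∈ S, Real.exp (-(η * L i)) / (∑ j ∈ S, Real.exp (-(η * L j))) *
        (e i - η / 2 * e i ^ 2) ≤ softMin η S (L + e) - softMin η S L := by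
  have h0 := sum_exp_pos η L hS
  set Z := ∑ j ∈ S, Real.exp (-(η * L j)) with hZ
  have h0' := sum_exp_pos η (L + e) hS
  set Z' := ∑ j ∈ S, Real.exp (-(η * (L + e) j)) with hZ'
  have h1 : Z' / Z ≤ 1 - η * ∑ i ∈ S, Real.exp (-(η * L i)) / Z * (e i - η / 2 * e i ^ 2) := by
    have h2 : (1 : ℝ) = ∑ i ∈ S, Real.exp (-(η * L i)) / Z := by
      rw [← Finset.sum_div, ← hZ, div_self h0.ne']
    rw [h2, hZ', Finset.sum_div, Finset.mul_sum, ← Finset.sum_sub_distrib]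
    refine Finset.sum_le_sum fun i hi => ?_
    have h3 : Real.exp (-(η * (L + e) i)) = Real.exp (-(η * L i)) * Real.exp (-(η * e i)) := by
      rw [← Real.exp_add, Pi.add_apply]
      congr 1
      ring
    have h4 := exp_neg_le_quadratic (mul_nonneg hη.le (he i hi))
    have h5 : 0 < Real.exp (-(η * L i)) / Z := div_pos (Real.exp_pos _) h0
    rw [h3, mul_div_right_comm]
    nlinarith
  have h6 := Real.log_le_sub_one_of_pos (div_pos h0' h0)
  rw [Real.log_div h0'.ne' h0.ne'] at h6
  unfold softMin
  have h7 : ∑ i ∈ S, Real.exp (-(η * L i)) / Z * (e i - η / 2 * e i ^ 2) ≤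
      (Real.log Z - Real.log Z') / η := by
    rw [le_div_iff₀ hη]
    linarith
  refine h7.trans (le_of_eq ?_)
  ring

theorem cappedSoftMin_mono {c : ℝ} (hη : 0 < η) (hS : S.Nonempty) (h : ∀ i, L i ≤ L' i) :
    cappedSoftMin c η S L ≤ cappedSoftMin c η S L' :=
  min_le_min (softMin_mono hη hS fun i _ => h i)
    (add_le_add (softMin_mono hη (hS.mono (Finset.subset_univ S)) fun i _ => h i) le_rfl)

end

/-! ### The loss estimates of the first stage -/

theorem sum_eq_sum_parts {K : ℕ} (P : Finpartition (Finset.univ : Finset (Fin K)))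
    (f : Fin K → ℝ) : ∑ i, f i = ∑ C ∈ P.parts, ∑ i ∈ C, f i := by
  conv_lhs => rw [← P.biUnion_parts]
  exact Finset.sum_biUnion P.disjoint

/-- The loss estimates of the first stage. -/
def exploreEstimate {K : ℕ} (G : Digraph (Fin K)) (p l : Fin K → ℝ) (a i : Fin K) : ℝ :=
  if 0 < p i then estimator G p (feedback G l a) i else 0

section

variable {K : ℕ} {G : Digraph (Fin K)} {P : Finpartition (Finset.univ : Finset (Fin K))}
  {p l : Fin K → ℝ}

theorem exploreEstimate_nonneg (hp : ∀ i, 0 ≤ p i) (hl : ∀ i, l i ∈ Set.Icc (0 : ℝ) 1)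
    (a i : Fin K) : 0 ≤ exploreEstimate G p l a i := by
  unfold exploreEstimate
  split_ifs
  · exact estimator_feedback_nonneg hp (fun i => (hl i).1) a i
  · exact le_rfl

theorem sum_part_le_obsProb (hG : SelfAware G) (hP : IsCliquePartition G P) (hp : ∀ i, 0 ≤ p i)
    {C : Finset (Fin K)} (hC : C ∈ P.parts) {i : Fin K} (hi : i ∈ C) :
    ∑ j ∈ C, p j ≤ obsProb G p i := by
  unfold obsProb
  calc ∑ j ∈ C, p j = ∑ j ∈ C, (if G.Adj j i then p j else 0) := by
        refine Finset.sum_congr rfl fun j hj => ?_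
        rw [if_pos]
        by_cases h : j = i
        · rw [h]
          exact hG i
        · exact hP C hC j hj i hi h
    _ ≤ _ := Finset.sum_le_sum_of_subset_of_nonneg (Finset.subset_univ C) fun j _ _ => by
        split_ifs
        exacts [hp j, le_rfl]

theorem exploreEstimate_le (hG : SelfAware G) (hP : IsCliquePartition G P) (hp : ∀ i, 0 ≤ p i)
    (hl : ∀ i, l i ∈ Set.Icc (0 : ℝ) 1) {C : Finset (Fin K)} (hC : C ∈ P.parts) {i : Fin K}
    (hi : i ∈ C) {b : ℝ} (hb : 0 < b) (hbC : b ≤ ∑ j ∈ C, p j) (a : Fin K) :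
    exploreEstimate G p l a i ≤ 1 / b := by
  unfold exploreEstimate
  rw [estimator_feedback]
  have hW := hbC.trans (sum_part_le_obsProb hG hP hp hC hi)
  split_ifs
  · exact div_le_div₀ zero_le_one (hl i).2 hb hW
  all_goals positivity

/-- Estimates are unbiased on arms with positive probability and vanish elsewhere. For the
comparator this bias is downwards, the favourable direction in a regret bound. -/
theorem sum_mul_exploreEstimate (hG : SelfAware G) (hp : ∀ i, 0 ≤ p i) (i : Fin K) :
    ∑ a, p a * exploreEstimate G p l a i = if 0 < p i then l i else 0 := by
  unfold exploreEstimate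
  split_ifs with h
  · exact sum_mul_estimator l (h.trans_le (le_obsProb hG hp i))
  · simp

theorem sum_mul_sum_exploreEstimate (hG : SelfAware G) (hp : ∀ i, 0 ≤ p i) :
    ∑ a, p a * ∑ i, p i * exploreEstimate G p l a i = ∑ i, p i * l i := by
  simp_rw [Finset.mul_sum]
  rw [Finset.sum_comm]
  refine Finset.sum_congr rfl fun i _ => ?_
  have h1 : ∑ a, p a * (p i * exploreEstimate G p l a i) =
      p i * ∑ a, p a * exploreEstimate G p l a i := by
    rw [Finset.mul_sum]
    exact Finset.sum_congr rfl fun a _ => by ring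
  rw [h1, sum_mul_exploreEstimate hG hp]
  split_ifs with h
  · rfl
  · rw [le_antisymm (not_lt.1 h) (hp i)]
    ring

/-- If all arms have positive probability, the estimated loss is at most the number of
cliques. -/
theorem sum_mul_exploreEstimate_le_card (hG : SelfAware G) (hP : IsCliquePartition G P)
    (hp : ∀ i, 0 < p i) (hl : ∀ i, l i ∈ Set.Icc (0 : ℝ) 1) (a : Fin K) :
    ∑ i, p i * exploreEstimate G p l a i ≤ P.parts.card := by
  rw [sum_eq_sum_parts P]
  have := Finset.sum_le_card_nsmul P.parts
    (fun C => ∑ i ∈ C, p i * exploreEstimate G p l a i) 1 fun C hC => by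
      have hpos : 0 < ∑ j ∈ C, p j :=
        Finset.sum_pos (fun j _ => hp j) (P.nonempty_of_mem_parts hC)
      calc ∑ i ∈ C, p i * exploreEstimate G p l a i
          ≤ ∑ i ∈ C, p i * (1 / ∑ j ∈ C, p j) := Finset.sum_le_sum fun i hi =>
            mul_le_mul_of_nonneg_left (exploreEstimate_le hG hP (fun i => (hp i).le) hl hC hi
              hpos le_rfl a) (hp i).le
        _ = 1 := by
            rw [← Finset.sum_mul, mul_one_div_cancel hpos.ne']
  simpa using this

/-! ### Clipping -/

theorem clipped_eq {q : Fin K → ℝ} {ε : ℝ} {C : Finset (Fin K)} (hC : C ∈ P.parts) {i : Fin K}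
    (hi : i ∈ C) : clipped P ε q i = if ∑ j ∈ C, q j ≤ ε then 0 else q i := by
  unfold clipped
  rw [P.part_eq_of_mem hC hi]

theorem clipped_nonneg {q : Fin K → ℝ} {ε : ℝ} (hq : ∀ i, 0 ≤ q i) (i : Fin K) :
    0 ≤ clipped P ε q i := by
  unfold clipped
  split_ifs
  exacts [le_rfl, hq i]

theorem clipped_le {q : Fin K → ℝ} {ε : ℝ} (hq : ∀ i, 0 ≤ q i) (i : Fin K) :
    clipped P ε q i ≤ q i := by
  unfold clipped
  split_ifs
  exacts [hq i, le_rfl]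

/-- Each clique loses at most `ε`, and only if it is dropped entirely. -/
theorem one_sub_le_sum_clipped {q : Fin K → ℝ} {ε : ℝ} (hq : ∀ i, 0 ≤ q i) (hq1 : ∑ i, q i = 1)
    (hε : 0 ≤ ε) : 1 - P.parts.card * ε ≤ ∑ i, clipped P ε q i := by
  have h1 : ∑ i, (q i - clipped P ε q i) ≤ P.parts.card * ε := by
    rw [sum_eq_sum_parts P, ← nsmul_eq_mul]
    refine Finset.sum_le_card_nsmul _ _ _ fun C hC => ?_
    by_cases h : ∑ j ∈ C, q j ≤ ε
    · refine le_trans (Finset.sum_le_sum fun i _ => ?_) h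
      linarith [clipped_nonneg (P := P) (ε := ε) hq i]
    · rw [Finset.sum_eq_zero fun i hi => by rw [clipped_eq hC hi, if_neg h, sub_self]]
      exact hε
  rw [Finset.sum_sub_distrib, hq1] at h1
  linarith

/-- The removed mass is at most `2κη ≤ 1/2`, so renormalizing raises probabilities by a factor of at
most `1 / (1 - 2κη) ≤ 1 + 4κη`. -/
theorem clip_spec {q : Fin K → ℝ} {η : ℝ} (hq : ∀ i, 0 ≤ q i) (hq1 : ∑ i, q i = 1)
    (hη : 0 < η) (hκ : 4 * P.parts.card * η ≤ 1) :
    (∀ i, 0 ≤ clip P (2 * η) q i) ∧ ∑ i, clip P (2 * η) q i = 1 ∧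
      (∀ i, clipped P (2 * η) q i ≤ clip P (2 * η) q i) ∧
      ∀ i, clip P (2 * η) q i ≤ (1 + 4 * P.parts.card * η) * clipped P (2 * η) q i := by
  have h1 := one_sub_le_sum_clipped (P := P) hq hq1 (by positivity : 0 ≤ 2 * η)
  have h2 : ∑ i, clipped P (2 * η) q i ≤ 1 := hq1 ▸ Finset.sum_le_sum fun i _ => clipped_le hq i
  have h3 := fun i => clipped_nonneg (P := P) (ε := 2 * η) hq i
  have hN : 0 < ∑ i, clipped P (2 * η) q i := by linarith
  refine ⟨fun i => div_nonneg (h3 i) hN.le, ?_, fun i => ?_, fun i => ?_⟩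
  · unfold clip
    rw [← Finset.sum_div, div_self hN.ne']
  · unfold clip
    rw [le_div_iff₀ hN]
    exact mul_le_of_le_one_right (h3 i) h2
  · unfold clip
    rw [div_le_iff₀ hN]
    have h4 : 1 ≤ (1 + 4 * P.parts.card * η) * ∑ i, clipped P (2 * η) q i := by
      have h5 : 0 ≤ (P.parts.card : ℝ) * η := by positivity
      nlinarith
    nlinarith [h3 i]

/-! ### One round of an epoch -/

/-- The potential of an epoch controls the estimated loss of the clipped exponential weights
distribution. -/
theorem sum_mul_exploreEstimate_le_potential (hG : SelfAware G) (hP : IsCliquePartition G P)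
    (hl : ∀ i, l i ∈ Set.Icc (0 : ℝ) 1) {η c : ℝ} (hη : 0 < η) (hκ : 4 * P.parts.card * η ≤ 1)
    (hc : 1 / 2 - Real.log (2 * η) ≤ c) {L e : Fin K → ℝ} (a : Fin K)
    (he : e = exploreEstimate G (clip P (2 * η) (softmax η L)) l a) :
    (∀ i, e i ≤ 1 / (2 * η)) ∧
    ∑ i, clip P (2 * η) (softmax η L) i * e i ≤
      (1 + 4 * P.parts.card * η) * (softMin η Finset.univ (L + e) - softMin η Finset.univ L) +
      4 * η / 3 * ∑ C ∈ P.parts, (cappedSoftMin c η C (L + e) - cappedSoftMin c η C L) := by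
  have hne : (Finset.univ : Finset (Fin K)).Nonempty := ⟨a, Finset.mem_univ a⟩
  set q := softmax η L with hq
  have hq0 : ∀ i, 0 < q i := softmax_pos η L
  have hq1 : ∑ i, q i = 1 := sum_softmax η L a
  obtain ⟨hp0, hp1, hlow, hup⟩ := clip_spec (P := P) (fun i => (hq0 i).le) hq1 hη hκ
  set p := clip P (2 * η) q
  have he0 : ∀ i, 0 ≤ e i := fun i => he ▸ exploreEstimate_nonneg hp0 hl a i
  have hLe : ∀ i, L i ≤ (L + e) i := fun i => by
    rw [Pi.add_apply]
    linarith [he0 i]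
  -- A dropped clique has probability zero, so its estimates are set to zero and its soft minimum
  -- stands still.
  have hdead : ∀ C ∈ P.parts, ∑ j ∈ C, q j ≤ 2 * η → ∀ i ∈ C, e i = 0 := by
    intro C hC h i hi
    have : ¬ 0 < p i := by
      rw [not_lt]
      refine (hup i).trans (le_of_eq ?_)
      rw [clipped_eq hC hi, if_pos h, mul_zero]
    rw [he, exploreEstimate, if_neg this]
  have halive : ∀ C ∈ P.parts, ¬ ∑ j ∈ C, q j ≤ 2 * η → ∀ i ∈ C, e i ≤ 1 / ∑ j ∈ C, q j := by
    intro C hC h i hi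
    rw [he]
    refine exploreEstimate_le hG hP hp0 hl hC hi (by linarith) ?_ a
    refine Finset.sum_le_sum fun j hj => ?_
    have := hlow j
    rwa [clipped_eq hC hj, if_neg h] at this
  have hbound : ∀ i, e i ≤ 1 / (2 * η) := by
    intro i
    have hC := P.part_mem.2 (Finset.mem_univ i)
    have hi := P.mem_part (Finset.mem_univ i)
    by_cases h : ∑ j ∈ P.part i, q j ≤ 2 * η
    · rw [hdead _ hC h i hi]
      positivity
    · refine (halive _ hC h i hi).trans (one_div_le_one_div_of_le (by positivity) ?_)
      linarith
  refine ⟨hbound, ?_⟩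
  have hclique : ∀ C ∈ P.parts, 0 ≤ cappedSoftMin c η C (L + e) - cappedSoftMin c η C L ∧
      ∑ i ∈ C, q i * e i ^ 2 ≤
        4 / 3 * (cappedSoftMin c η C (L + e) - cappedSoftMin c η C L) := by
    intro C hC
    have hCne := P.nonempty_of_mem_parts hC
    have hmono := sub_nonneg.2 (cappedSoftMin_mono (c := c) hη hCne hLe)
    refine ⟨hmono, ?_⟩
    by_cases h : ∑ j ∈ C, q j ≤ 2 * η
    · rw [Finset.sum_eq_zero fun i hi => by rw [hdead C hC h i hi]; ring]
      positivity
    have hqC : 2 * η < ∑ j ∈ C, q j := not_le.1 h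
    have hZ := sum_exp_pos η L hne
    have hZC := sum_exp_pos η L hCne
    have hqCeq : ∑ j ∈ C, q j =
        (∑ j ∈ C, Real.exp (-(η * L j))) / ∑ j, Real.exp (-(η * L j)) := by
      rw [Finset.sum_div]
      rfl
    -- The cap is inactive after the step: mass above `2η` puts the soft minimum of `C` within `-log
    -- (2η) / η` of the global one, and one round adds at most `1 / (2η)`. The hypothesis on `c` is
    -- the sum of these two, multiplied by `η`.
    have hcap : cappedSoftMin c η C (L + e) = softMin η C (L + e) := by
      refine min_eq_left ?_
      have h1 := softMin_add_le (L := L) hη hCne (e := e) fun i _ => hbound i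
      have h2 : softMin η Finset.univ L ≤ softMin η Finset.univ (L + e) :=
        softMin_mono hη hne fun i _ => hLe i
      have h3 : softMin η C L ≤ softMin η Finset.univ L - Real.log (2 * η) / η := by
        have h4 := Real.log_le_log (by positivity) hqC.le
        rw [hqCeq, Real.log_div hZC.ne' hZ.ne'] at h4
        unfold softMin
        have h5 := div_le_div_of_nonneg_right h4 hη.le
        rw [sub_div] at h5
        rw [one_div, ← div_eq_inv_mul, ← div_eq_inv_mul]
        linarith
      have h6 := div_le_div_of_nonneg_right hc hη.le
      rw [sub_div, div_div] at h6
      linarith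
    have hcap' : cappedSoftMin c η C L ≤ softMin η C L := min_le_left _ _
    have hstep := sum_sub_le_softMin_sub (L := L) hη hCne (e := e) fun i _ => he0 i
    -- Two uses of the bounds on `e`: `q i * e i ≤ q i / q(C)` turns the square into a conditional
    -- loss, and `e i ≤ 1 / (2η)` leaves three quarters of it after the second-order correction.
    have hsum : 3 / 4 * ∑ i ∈ C, q i * e i ^ 2 ≤
        ∑ i ∈ C, Real.exp (-(η * L i)) / (∑ j ∈ C, Real.exp (-(η * L j))) *
          (e i - η / 2 * e i ^ 2) := by
      rw [Finset.mul_sum]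
      refine Finset.sum_le_sum fun i hi => ?_
      have h1 : Real.exp (-(η * L i)) / (∑ j ∈ C, Real.exp (-(η * L j))) =
          q i / ∑ j ∈ C, q j := by
        rw [hqCeq, hq, softmax, div_div_div_cancel_right₀ hZ.ne']
      have hr : 0 ≤ q i / ∑ j ∈ C, q j := div_nonneg (hq0 i).le (by linarith)
      rw [h1]
      have h2 : q i * e i ≤ q i / ∑ j ∈ C, q j := by
        rw [div_eq_mul_one_div]
        exact mul_le_mul_of_nonneg_left (halive C hC h i hi) (hq0 i).le
      have h3 : η / 2 * e i ^ 2 ≤ 1 / 4 * e i := by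
        have := mul_le_mul_of_nonneg_left (hbound i) (mul_nonneg hη.le (he0 i))
        have h4 : η * e i * (1 / (2 * η)) = 1 / 2 * e i := by field_simp
        nlinarith
      have h5 : q i * e i ^ 2 ≤ q i / (∑ j ∈ C, q j) * e i := by
        have := mul_le_mul_of_nonneg_right h2 (he0 i)
        nlinarith
      have h6 := mul_le_mul_of_nonneg_left h3 hr
      linarith
    rw [hcap]
    linarith
  have hsq : ∑ i, q i * e i ^ 2 ≤
      4 / 3 * ∑ C ∈ P.parts, (cappedSoftMin c η C (L + e) - cappedSoftMin c η C L) := by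
    rw [sum_eq_sum_parts P, Finset.mul_sum]
    exact Finset.sum_le_sum fun C hC => (hclique C hC).2
  have hnn : 0 ≤ ∑ C ∈ P.parts, (cappedSoftMin c η C (L + e) - cappedSoftMin c η C L) :=
    Finset.sum_nonneg fun C hC => (hclique C hC).1
  have hall := sum_sub_le_softMin_sub (L := L) hη hne (e := e) fun i _ => he0 i
  change ∑ i, q i * (e i - η / 2 * e i ^ 2) ≤ _ at hall
  have hsplit : ∑ i, q i * (e i - η / 2 * e i ^ 2) =
      ∑ i, q i * e i - η / 2 * ∑ i, q i * e i ^ 2 := by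
    rw [Finset.mul_sum, ← Finset.sum_sub_distrib]
    exact Finset.sum_congr rfl fun i _ => by ring
  have hpe : ∑ i, p i * e i ≤ (1 + 4 * P.parts.card * η) * ∑ i, q i * e i := by
    rw [Finset.mul_sum]
    refine Finset.sum_le_sum fun i _ => ?_
    rw [← mul_assoc]
    refine mul_le_mul_of_nonneg_right ((hup i).trans ?_) (he0 i)
    exact mul_le_mul_of_nonneg_left (clipped_le (fun i => (hq0 i).le) i) (by positivity)
  set D := softMin η Finset.univ (L + e) - softMin η Finset.univ L
  set X := ∑ C ∈ P.parts, (cappedSoftMin c η C (L + e) - cappedSoftMin c η C L)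
  have h1 : ∑ i, q i * e i ≤ D + 2 * η / 3 * X := by
    have := mul_le_mul_of_nonneg_left hsq (by positivity : 0 ≤ η / 2)
    linarith
  -- The factor `1 + 4κη ≤ 2` turns the coefficient `2η/3` of the clique terms into `4η/3`.
  have h2 := mul_le_mul_of_nonneg_left h1
    (by positivity : 0 ≤ 1 + 4 * (P.parts.card : ℝ) * η)
  have h3 : 0 ≤ η * X := by positivity
  have h4 := mul_le_mul_of_nonneg_right hκ h3
  linarith

end

/-! ### The potential of an epoch -/

/-- The part of the regret budget of an epoch that is left when the loss estimates of the epoch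
sum to `L`. -/
def epochPotential {K : ℕ} (P : Finpartition (Finset.univ : Finset (Fin K))) (c η : ℝ)
    (best : Fin K) (L : Fin K → ℝ) : ℝ :=
  3 * c / η - (1 + 4 * P.parts.card * η) * softMin η Finset.univ L -
    4 * η / 3 * ∑ C ∈ P.parts, cappedSoftMin c η C L + L best

/-- The budget for the unclipped first round of an epoch. -/
def firstRoundBudget {K : ℕ} (P : Finpartition (Finset.univ : Finset (Fin K)))
    (L : Fin K → ℝ) : ℝ :=
  if L = 0 then P.parts.card else 0

section

variable {K : ℕ} {G : Digraph (Fin K)} {P : Finpartition (Finset.univ : Finset (Fin K))}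
  {c η : ℝ} {best : Fin K}

theorem firstRoundBudget_nonneg (L : Fin K → ℝ) : 0 ≤ firstRoundBudget P L := by
  unfold firstRoundBudget
  split_ifs <;> positivity

/-- At zero losses every soft minimum is at least `-log K / η`, and the sum over cliques is weighted
by `η κ ≤ 1/4`; so opening an epoch costs a constant times `c / η`. -/
theorem epochPotential_zero_le (hη : 0 < η) (hκ : 4 * P.parts.card * η ≤ 1) (hc : 1 ≤ c)
    (hK : Real.log K ≤ c) :
    epochPotential P c η best 0 + firstRoundBudget P (0 : Fin K → ℝ) ≤ 6 * c * (1 / η) := by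
  have hne : (Finset.univ : Finset (Fin K)).Nonempty := ⟨best, Finset.mem_univ best⟩
  have hL : ∀ i, 0 ≤ (0 : Fin K → ℝ) i := fun i => le_rfl
  have hKη : Real.log K / η ≤ c / η := by gcongr
  have h1 : -(c / η) ≤ softMin η Finset.univ (0 : Fin K → ℝ) :=
    (neg_le_neg hKη).trans (neg_log_div_le_softMin hη hne hL)
  have hcη : 0 < c / η := by positivity
  have h2 : -(P.parts.card * (c / η)) ≤ ∑ C ∈ P.parts, cappedSoftMin c η C (0 : Fin K → ℝ) := by
    rw [← mul_neg, ← nsmul_eq_mul]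
    refine Finset.card_nsmul_le_sum _ _ _ fun C hC => le_min ?_ (by linarith)
    exact (neg_le_neg hKη).trans (neg_log_div_le_softMin hη (P.nonempty_of_mem_parts hC) hL)
  have h3 := mul_le_mul_of_nonneg_left h1 (by positivity : 0 ≤ 1 + 4 * (P.parts.card : ℝ) * η)
  have h4 := mul_le_mul_of_nonneg_left h2 (by positivity : 0 ≤ 4 * η / 3)
  have h5 := mul_le_mul_of_nonneg_right hκ hcη.le
  have h6 : (P.parts.card : ℝ) ≤ 1 / 4 * (c / η) := by
    rw [mul_div_assoc', le_div_iff₀ hη]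
    linarith
  unfold epochPotential firstRoundBudget
  rw [if_pos rfl, Pi.zero_apply, mul_div_assoc 3, mul_one_div, mul_div_assoc 6]
  linarith

/-- All soft minima are at most the loss of arm `i`, up to the cap `c / η`. What remains against
`3c/η` is `16/3 * η κ L i ≤ 2/η` and `4κc/3 ≤ c/(3η)`. The slack `2κ` allows for one round beyond
the restart test. -/
theorem epochPotential_nonneg (hη : 0 < η) (hκ : 4 * P.parts.card * η ≤ 1) (hc : 1 ≤ c)
    {L : Fin K → ℝ} {i : Fin K} (hi : L i ≤ L best)
    (hLi : 4 * η * P.parts.card * L i ≤ 1 / η + 2 * P.parts.card) :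
    0 ≤ epochPotential P c η best L := by
  have h1 : softMin η Finset.univ L ≤ L i := softMin_le hη (Finset.mem_univ i)
  have h2 : ∑ C ∈ P.parts, cappedSoftMin c η C L ≤ P.parts.card * (L i + c / η) := by
    rw [← nsmul_eq_mul]
    exact Finset.sum_le_card_nsmul _ _ _ fun C _ => (min_le_right _ _).trans (by linarith)
  have h3 := mul_le_mul_of_nonneg_left h1 (by positivity : 0 ≤ 1 + 4 * (P.parts.card : ℝ) * η)
  have h4 := mul_le_mul_of_nonneg_left h2 (by positivity : 0 ≤ 4 * η / 3)
  have hcη : 1 / η ≤ c / η := by gcongr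
  have h5 := mul_le_mul_of_nonneg_right hκ ((by positivity : 0 ≤ 1 / η).trans hcη)
  have h6 : (P.parts.card : ℝ) ≤ 1 / 4 * (1 / η) := by
    rw [mul_div_assoc', le_div_iff₀ hη]
    linarith
  unfold epochPotential
  rw [mul_div_assoc]
  nlinarith

theorem epochPotential_mono_of_le (hη : 0 < η) {L e : Fin K → ℝ} (he : ∀ i, 0 ≤ e i) :
    epochPotential P c η best (L + e) ≤ epochPotential P c η best L + e best := by
  have hne : (Finset.univ : Finset (Fin K)).Nonempty := ⟨best, Finset.mem_univ best⟩
  have hLe : ∀ i, L i ≤ (L + e) i := fun i => by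
    rw [Pi.add_apply]
    linarith [he i]
  have h1 := mul_le_mul_of_nonneg_left (softMin_mono hη hne fun i _ => hLe i)
    (by positivity : 0 ≤ 1 + 4 * (P.parts.card : ℝ) * η)
  have h2 := mul_le_mul_of_nonneg_left
    (Finset.sum_le_sum fun C hC => cappedSoftMin_mono (c := c) hη (P.nonempty_of_mem_parts hC) hLe)
    (by positivity : 0 ≤ 4 * η / 3)
  unfold epochPotential
  rw [Pi.add_apply]
  linarith

/-- What holds in each round of the first stage. -/
structure ExploreInv (T : ℕ) (G : Digraph (Fin K))
    (P : Finpartition (Finset.univ : Finset (Fin K))) (s : ExploreState K) : Prop where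
  m_le : s.m ≤ Nat.log 2 T
  η_pos : 0 < s.η
  η_le : 4 * P.parts.card * s.η ≤ 1
  ε_eq : s.ε = 2 * s.η
  -- Keeps `-log (2η)` below `log T`, and makes the maximum with `1/T` in the clipping threshold
  -- ineffective.
  le_ε : 1 / (T : ℝ) ≤ 2 * s.η
  pHat_eq : s.pHat = softmax s.η s.cum
  p_eq : s.p = clip P (2 * s.η) (softmax s.η s.cum) ∨ s.cum = 0 ∧ s.p = uniform K
  cum_nonneg : ∀ i, 0 ≤ s.cum i
  cum_lt : 4 * s.η * P.parts.card * ⨅ i, s.cum i < 1 / s.η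

theorem ExploreInv.p_spec {T : ℕ} {s : ExploreState K} (h : ExploreInv T G P s) (i₀ : Fin K) :
    (∀ i, 0 ≤ s.p i) ∧ ∑ i, s.p i = 1 := by
  rcases h.p_eq with hp | ⟨-, hp⟩
  · rw [hp]
    have := clip_spec (P := P) (fun i => (softmax_pos s.η s.cum i).le)
      (sum_softmax s.η s.cum i₀) h.η_pos h.η_le
    exact ⟨this.1, this.2.1⟩
  · rw [hp, ← softmax_zero 1]
    exact ⟨fun i => (softmax_pos _ _ i).le, sum_softmax _ _ i₀⟩

theorem exists_iInf_eq (L : Fin K → ℝ) (i₀ : Fin K) : ∃ i, L i = ⨅ j, L j :=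
  haveI : Nonempty (Fin K) := ⟨i₀⟩
  exists_eq_ciInf_of_finite

theorem iInf_apply_le (L : Fin K → ℝ) (i : Fin K) : ⨅ j, L j ≤ L i :=
  ciInf_le (Set.finite_range L).bddBelow i

/-- One round of an epoch is paid for by the potential. -/
theorem ExploreInv.round {T : ℕ} {s : ExploreState K} (h : ExploreInv T G P s)
    (hG : SelfAware G) (hP : IsCliquePartition G P) {l : Fin K → ℝ}
    (hl : ∀ i, l i ∈ Set.Icc (0 : ℝ) 1) (hc : 1 ≤ c) (hcT : 1 / 2 + Real.log T ≤ c)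
    (hT : 0 < T) {e : Fin K → ℝ} (a : Fin K) (he : e = exploreEstimate G s.p l a) :
    (∑ i, s.p i * e i - e best ≤
      epochPotential P c s.η best s.cum + firstRoundBudget P s.cum) ∧
    epochPotential P c s.η best (s.cum + e) + firstRoundBudget P (s.cum + e) ≤
      epochPotential P c s.η best s.cum + firstRoundBudget P s.cum -
        (∑ i, s.p i * e i - e best) := by
  have hη := h.η_pos
  have hp := h.p_spec a
  have he0 : ∀ i, 0 ≤ e i := fun i => he ▸ exploreEstimate_nonneg hp.1 hl a i
  have hT' : (0 : ℝ) < T := by exact_mod_cast hT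
  have hcη : 1 / 2 - Real.log (2 * s.η) ≤ c := by
    have := Real.log_le_log (by positivity) h.le_ε
    rw [one_div, Real.log_inv] at this
    linarith
  have hbudget : firstRoundBudget P (s.cum + e) ≤ firstRoundBudget P s.cum := by
    unfold firstRoundBudget
    split_ifs with h1 h2 h2
    · exact le_rfl
    · refine absurd ?_ h2
      ext i
      have h3 := congrFun h1 i
      simp only [Pi.add_apply, Pi.zero_apply] at h3 ⊢
      linarith [he0 i, h.cum_nonneg i]
    · positivity
    · exact le_rfl
  have hcase : ∀ j, s.cum j = ⨅ j, s.cum j →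
      4 * s.η * P.parts.card * s.cum j ≤ 1 / s.η + 2 * P.parts.card := fun j hj => by
    have := h.cum_lt
    rw [← hj] at this
    have : (0 : ℝ) ≤ 2 * P.parts.card := by positivity
    linarith
  obtain ⟨j, hj⟩ := exists_iInf_eq s.cum a
  rcases h.p_eq with hp' | ⟨hcum, hp'⟩
  · rw [hp'] at he
    obtain ⟨hb, hle⟩ := sum_mul_exploreEstimate_le_potential hG hP hl hη h.η_le hcη (c := c) a he
    rw [← hp', Finset.sum_sub_distrib] at hle
    have h2 : epochPotential P c s.η best (s.cum + e) ≤
        epochPotential P c s.η best s.cum - (∑ i, s.p i * e i - e best) := by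
      unfold epochPotential
      rw [Pi.add_apply]
      linarith
    obtain ⟨i, hi⟩ := exists_iInf_eq (s.cum + e) a
    have h3 : 0 ≤ epochPotential P c s.η best (s.cum + e) := by
      refine epochPotential_nonneg hη h.η_le hc (i := i) (hi ▸ iInf_apply_le _ best) ?_
      -- The test was negative before this round and an estimate is at most `1 / (2η)`, so the
      -- minimum overshoots by at most that amount; multiplied by `4ηκ` this is the slack `2κ`.
      have h4 : (s.cum + e) i ≤ s.cum j + 1 / (2 * s.η) := by
        rw [hi]
        refine (iInf_apply_le _ j).trans ?_
        rw [Pi.add_apply]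
        linarith [hb j]
      refine (mul_le_mul_of_nonneg_left h4 (by positivity)).trans ?_
      rw [mul_add, hj]
      have h5 : 4 * s.η * (P.parts.card : ℝ) * (1 / (2 * s.η)) = 2 * P.parts.card := by
        field_simp
        ring
      rw [h5]
      linarith [h.cum_lt]
    have := firstRoundBudget_nonneg (P := P) s.cum
    exact ⟨by linarith, by linarith⟩
  · have hpos : ∀ i, 0 < s.p i := fun i => by
      rw [hp', ← softmax_zero 1]
      exact softmax_pos _ _ i
    have h1 : ∑ i, s.p i * e i ≤ P.parts.card := by
      rw [he]
      exact sum_mul_exploreEstimate_le_card hG hP hpos hl a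
    have h2 : firstRoundBudget P s.cum = P.parts.card := if_pos hcum
    have h3 : 0 ≤ epochPotential P c s.η best s.cum :=
      epochPotential_nonneg hη h.η_le hc (hj ▸ iInf_apply_le _ best) (hcase j hj)
    refine ⟨by linarith [he0 best], ?_⟩
    -- The uniform first round is unclipped, so individual estimates may exceed `1 / (2η)`; its cost
    -- is instead at most `κ`. The budget for this is released at the first nonzero estimate, and a
    -- zero estimate costs nothing.
    by_cases he' : e = 0
    · simp [he']
    · have h4 : firstRoundBudget P (s.cum + e) = 0 := by
        rw [hcum, zero_add]
        exact if_neg he'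
      have := epochPotential_mono_of_le (P := P) (c := c) (best := best) hη (L := s.cum) he0
      linarith

theorem ExploreInv.potential_nonneg {T : ℕ} {s : ExploreState K} (h : ExploreInv T G P s)
    (hc : 1 ≤ c) : 0 ≤ epochPotential P c s.η best s.cum := by
  obtain ⟨j, hj⟩ := exists_iInf_eq s.cum best
  refine epochPotential_nonneg h.η_pos h.η_le hc (hj ▸ iInf_apply_le _ best) ?_
  rw [hj]
  have : (0 : ℝ) ≤ 2 * P.parts.card := by positivity
  linarith [h.cum_lt]

end

/-! ### The potential of the algorithm -/

/-- The loss of arm `i` from round `t` on. -/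
def remainingLoss {K T : ℕ} (l : Fin T → Fin K → ℝ) (i : Fin K) (t : ℕ) : ℝ :=
  ∑ τ : Fin T, if t ≤ τ then l τ i else 0

theorem remainingLoss_zero {K T : ℕ} (l : Fin T → Fin K → ℝ) (i : Fin K) :
    remainingLoss l i 0 = totalLoss l i := by
  simp [remainingLoss, totalLoss]

theorem remainingLoss_eq {K T : ℕ} (l : Fin T → Fin K → ℝ) (i : Fin K) (t : Fin T) :
    remainingLoss l i t = l t i + remainingLoss l i (t + 1) := by
  unfold remainingLoss
  have : l t i = ∑ τ : Fin T, if τ = t then l τ i else 0 := by simp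
  rw [this, ← Finset.sum_add_distrib]
  refine Finset.sum_congr rfl fun τ _ => ?_
  rcases lt_trichotomy τ t with h | h | h
  · have h1 : ¬ (t : ℕ) ≤ τ := not_le.2 h
    have h2 : ¬ (t : ℕ) + 1 ≤ τ := by omega
    simp [h1, h2, h.ne]
  · simp [h]
  · have h1 : (t : ℕ) ≤ τ := le_of_lt h
    have h2 : (t : ℕ) + 1 ≤ τ := h
    simp [h1, h2, h.ne']

theorem remainingLoss_mem {K T : ℕ} {l : Fin T → Fin K → ℝ} {i : Fin K}
    (hl : ∀ t, 0 ≤ l t i) (t : ℕ) :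
    remainingLoss l i t ∈ Set.Icc 0 (totalLoss l i) := by
  unfold remainingLoss totalLoss
  constructor
  · refine Finset.sum_nonneg fun τ _ => ?_
    split_ifs
    exacts [hl τ, le_rfl]
  · refine Finset.sum_le_sum fun τ _ => ?_
    split_ifs
    exacts [le_rfl, hl τ]

/-- The budget for the later epochs of a meta-epoch, in terms of the inverse learning rate. -/
def laterEpochsBudget (c lam x : ℝ) : ℝ :=
  12 * c * max 0 (2 * lam - x)

/-- The potential of the first stage. -/
def explorePotential {K : ℕ} (P : Finpartition (Finset.univ : Finset (Fin K))) (c lam : ℝ)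
    (A b : ℕ → ℝ) (best : Fin K) (rem : ℝ) (s : ExploreState K) : ℝ :=
  epochPotential P c s.η best s.cum + firstRoundBudget P s.cum +
    laterEpochsBudget c lam (1 / s.η) + A s.m + b s.m * (s.cum best + rem)

/-- The bound on the increment of regret in a round of the second stage. -/
def exploitRate {K : ℕ} (T : ℕ) (G : Digraph (Fin K)) : ℝ :=
  K / T + rate2 T G * (2 * independenceNumber G * (Nat.log 2 T + 1))

/-- The potential of the second stage. -/
def exploitPotential {K : ℕ} (T : ℕ) (G : Digraph (Fin K)) (best : Fin K) (t : ℕ)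
    (p : Fin K → ℝ) : ℝ :=
  bregman (reg2 T G) (comparator T best) p + (T - t) * exploitRate T G

/-- A bound on the regret of the second stage. -/
def exploitBudget {K : ℕ} (T : ℕ) (G : Digraph (Fin K)) : ℝ :=
  √((independenceNumber G : ℝ) * T) * Real.log T + 64 * K ^ 2 * Real.log T + K +
    2 * √((independenceNumber G : ℝ) * T) * (Nat.log 2 T + 1)

/-- The potential of the algorithm. -/
def twoStagePotential {K T : ℕ} (G : Digraph (Fin K))
    (P : Finpartition (Finset.univ : Finset (Fin K))) (l : Fin T → Fin K → ℝ) (c lam : ℝ)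
    (A b : ℕ → ℝ) (best : Fin K) (t : ℕ) : TwoStageState K → ℝ
  | .explore s => explorePotential P c lam A b best (remainingLoss l best t) s
  | .exploit p => exploitPotential T G best t p

/-- What holds in each round. -/
def TwoStageInv {K : ℕ} (T : ℕ) (G : Digraph (Fin K))
    (P : Finpartition (Finset.univ : Finset (Fin K))) : TwoStageState K → Prop
  | .explore s => ExploreInv T G P s
  | .exploit p => p ∈ clippedSimplex K T

/-- The conditions under which budgets `A` and `b` for the meta-epochs suffice. -/
structure Budget {K : ℕ} (T : ℕ) (G : Digraph (Fin K)) (κ c lam tot : ℝ) (A b : ℕ → ℝ) :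
    Prop where
  A_nonneg : ∀ m, m ≤ Nat.log 2 T → 0 ≤ A m
  b_nonneg : ∀ m, 0 ≤ b m
  -- Here `x` is the inverse rate of the finished epoch and `y` the estimated loss of the comparator
  -- in it. The term `12 c x` opens the next epoch, at six times `c` times the inverse rate `2x`.
  epoch : ∀ x y : ℝ, ∀ n : ℕ, 0 < x → 0 ≤ y → x ^ 2 ≤ 4 * κ * y →
    2 * x < √((independenceNumber G : ℝ) * T) →
    12 * c * x + laterEpochsBudget c lam (2 * x) ≤ laterEpochsBudget c lam x + b n * y
  -- `r` is the remaining true loss of the comparator; the new meta-epoch restarts at inverse rate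
  -- `4κ`.
  metaEpoch : ∀ n y r, n + 1 ≤ Nat.log 2 T →
    (independenceNumber G : ℝ) * T ≤ 16 * κ * y → 0 ≤ r → r ≤ tot →
    24 * c * κ + laterEpochsBudget c lam (4 * κ) + A (n + 1) + b (n + 1) * r ≤
      A n + b n * (y + r)
  exploit : ∀ y r, (independenceNumber G : ℝ) * T ≤ 16 * κ * y → 0 ≤ r →
    exploitBudget T G ≤ A (Nat.log 2 T) + b (Nat.log 2 T) * (y + r)

theorem laterEpochsBudget_nonneg {c lam x : ℝ} (hc : 0 ≤ c) : 0 ≤ laterEpochsBudget c lam x :=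
  mul_nonneg (by positivity) (le_max_left _ _)

/-! ### The potential along both stages. -/

section

variable {K T : ℕ} {G : Digraph (Fin K)} {P : Finpartition (Finset.univ : Finset (Fin K))}
  {c lam tot : ℝ} {A b : ℕ → ℝ} {best : Fin K}

theorem exploitRate_nonneg : 0 ≤ exploitRate T G := by
  unfold exploitRate rate2
  positivity

theorem exploitPotential_argminOn_le (hT : 0 < T) (hKT : K ≤ T) (t : ℕ) :
    exploitPotential T G best t (argminOn (reg2 T G) (clippedSimplex K T)) ≤
      exploitBudget T G := by
  have h1 := bregman_reg2_argminOn_le (G := G) hT hKT best (comparator_mem hT hKT best)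
  have hT' : (0 : ℝ) < T := by exact_mod_cast hT
  have hα : (0 : ℝ) < independenceNumber G := by exact_mod_cast one_le_independenceNumber G best
  have h2 : ((T : ℝ) - t) * exploitRate T G ≤ T * exploitRate T G :=
    mul_le_mul_of_nonneg_right (by linarith [(Nat.cast_nonneg t : (0 : ℝ) ≤ t)])
      exploitRate_nonneg
  have h3 : (T : ℝ) * exploitRate T G =
      K + 2 * √((independenceNumber G : ℝ) * T) * (Nat.log 2 T + 1) := by
    unfold exploitRate rate2
    have h4 : 0 < √((independenceNumber G : ℝ) * T) := by positivity
    have h5 : √((independenceNumber G : ℝ) * T) ^ 2 = independenceNumber G * T :=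
      Real.sq_sqrt (by positivity)
    generalize √((independenceNumber G : ℝ) * T) = q at h4 h5 ⊢
    field_simp
    linear_combination (-2 * (Nat.log 2 T + 1 : ℝ)) * h5
  unfold exploitPotential exploitBudget
  linarith

theorem exploitPotential_step (hG : SelfAware G) (hT : 0 < T) (hKT : K ≤ T)
    {l p : Fin K → ℝ} (hl : ∀ i, l i ∈ Set.Icc (0 : ℝ) 1) (hp : p ∈ clippedSimplex K T) (t : ℕ) :
    ∑ a, p a * (l a - l best + exploitPotential T G best (t + 1)
      (omdStep (reg2 T G) (clippedSimplex K T) (estimator G p (feedback G l a)) p)) ≤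
      exploitPotential T G best t p := by
  have h1 := exploit_step hG hT best (comparator_mem hT hKT best) hp hl
  have h2 := sum_comparator_mul_le (T := T) best hl
  unfold exploitPotential
  have h3 : ∀ a, p a * (l a - l best + (bregman (reg2 T G) (comparator T best)
      (omdStep (reg2 T G) (clippedSimplex K T) (estimator G p (feedback G l a)) p) +
        (T - ((t + 1 : ℕ) : ℝ)) * exploitRate T G)) =
      p a * (l a - ∑ i, comparator T best i * l i + bregman (reg2 T G) (comparator T best)
        (omdStep (reg2 T G) (clippedSimplex K T) (estimator G p (feedback G l a)) p)) +
      p a * (∑ i, comparator T best i * l i - l best +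
        (T - ((t + 1 : ℕ) : ℝ)) * exploitRate T G) := fun a => by ring
  simp_rw [h3]
  rw [Finset.sum_add_distrib, ← Finset.sum_mul, hp.1.2, one_mul]
  push_cast
  have h4 : exploitRate T G =
      K / T + rate2 T G * (2 * independenceNumber G * (Nat.log 2 T + 1)) := rfl
  linarith

theorem startEpoch_inv {m : ℕ} {η : ℝ} (i₀ : Fin K) (hm : m ≤ Nat.log 2 T) (hη : 0 < η)
    (hκ : 4 * P.parts.card * η ≤ 1) (hT : 1 / (T : ℝ) ≤ 2 * η) :
    TwoStageInv T G P (startEpoch K m η (2 * η)) := by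
  have : Nonempty (Fin K) := ⟨i₀⟩
  refine ⟨hm, hη, hκ, rfl, hT, (softmax_zero η).symm, Or.inr ⟨rfl, rfl⟩, fun i => le_rfl, ?_⟩
  simp only [Pi.zero_apply, ciInf_const, mul_zero]
  positivity

theorem startEpoch_potential_le {l : Fin T → Fin K → ℝ} {m : ℕ} {η ε : ℝ} (hη : 0 < η)
    (hκ : 4 * P.parts.card * η ≤ 1) (hc : 1 ≤ c) (hK : Real.log K ≤ c) (t : ℕ) :
    twoStagePotential G P l c lam A b best t (startEpoch K m η ε) ≤
      6 * c * (1 / η) + laterEpochsBudget c lam (1 / η) + A m +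
        b m * remainingLoss l best t := by
  have := epochPotential_zero_le (P := P) (best := best) hη hκ hc hK
  change epochPotential P c η best 0 + firstRoundBudget P 0 + laterEpochsBudget c lam (1 / η) +
    A m + b m * ((0 : Fin K → ℝ) best + remainingLoss l best t) ≤ _
  rw [Pi.zero_apply, zero_add]
  linarith

theorem exploreUpdate_eq {T : ℕ} {s : ExploreState K} (h : ExploreInv T G P s) (ηi εi : ℝ)
    (l : Fin K → ℝ) (a : Fin K) :
    exploreUpdate T G P ηi εi s (feedback G l a) =
      if 1 / s.η ≤ 4 * s.η * P.parts.card * ⨅ i, (s.cum + exploreEstimate G s.p l a) i then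
        if s.η / 2 ≤ √(1 / ((independenceNumber G : ℝ) * T)) then
          startMetaEpoch T G ηi εi (s.m + 1)
        else startEpoch K s.m (s.η / 2) (max (2 * (s.η / 2)) (1 / T))
      else .explore { s with
        pHat := softmax s.η (s.cum + exploreEstimate G s.p l a)
        p := clip P s.ε (softmax s.η (s.cum + exploreEstimate G s.p l a))
        cum := s.cum + exploreEstimate G s.p l a } := by
  rw [← omdStep_softmax a h.η_pos, ← h.pHat_eq]
  rfl

/-- From `α ≤ K ≤ T`. A new epoch in the same meta-epoch has a rate above the right-hand side, hence
above `1/T`. -/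
theorem one_div_le_sqrt (hT : 0 < T) (hKT : K ≤ T) (i₀ : Fin K) :
    1 / (T : ℝ) ≤ √(1 / ((independenceNumber G : ℝ) * T)) := by
  have hT' : (0 : ℝ) < T := by exact_mod_cast hT
  have hα : (0 : ℝ) < independenceNumber G := by exact_mod_cast one_le_independenceNumber G i₀
  have hαT : (independenceNumber G : ℝ) ≤ T := by
    exact_mod_cast (independenceNumber_le G).trans hKT
  refine Real.le_sqrt_of_sq_le ?_
  rw [div_pow, one_pow, sq]
  exact one_div_le_one_div_of_le (by positivity) (by gcongr)

theorem startMetaEpoch_inv (hT : 0 < T) (hKT : 2 * K ≤ T) (hκ : 0 < P.parts.card)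
    (i₀ : Fin K) (m : ℕ) :
    TwoStageInv T G P (startMetaEpoch T G (1 / (4 * (P.parts.card : ℝ)))
      (1 / (2 * (P.parts.card : ℝ))) m) := by
  have hκ' : (0 : ℝ) < P.parts.card := by exact_mod_cast hκ
  unfold startMetaEpoch
  split_ifs with hm
  · have h1 : 1 / (2 * (P.parts.card : ℝ)) = 2 * (1 / (4 * (P.parts.card : ℝ))) := by
      field_simp
      norm_num
    rw [h1]
    refine startEpoch_inv i₀ hm (by positivity) (le_of_eq (by field_simp)) ?_
    rw [← h1]
    -- `T ≥ 2K ≥ 2κ` is what the initial threshold `1 / (2κ)` needs to be at least `1/T`.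
    refine one_div_le_one_div_of_le (by positivity) ?_
    have h2 : P.parts.card ≤ K := by simpa using P.card_parts_le_card
    exact_mod_cast (Nat.mul_le_mul_left 2 h2).trans hKT
  · exact (argminOn_reg2_spec hT (by omega) i₀).1

theorem TwoStageInv.update (hT : 0 < T) (hKT : 2 * K ≤ T) (hκ : 0 < P.parts.card)
    {l : Fin K → ℝ} (hl : ∀ i, l i ∈ Set.Icc (0 : ℝ) 1) (s : TwoStageState K) (a : Fin K)
    (hs : TwoStageInv T G P s) :
    TwoStageInv T G P ((twoStage T G P (1 / (4 * (P.parts.card : ℝ)))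
      (1 / (2 * (P.parts.card : ℝ)))).update s a (feedback G l a)) := by
  rcases s with s | p
  · change ExploreInv T G P s at hs
    change TwoStageInv T G P (exploreUpdate T G P _ _ s (feedback G l a))
    rw [exploreUpdate_eq hs]
    have hη := hs.η_pos
    split_ifs with h1 h2
    · exact startMetaEpoch_inv hT hKT hκ a _
    · have h3 : 1 / (T : ℝ) ≤ 2 * (s.η / 2) := by
        have := one_div_le_sqrt (G := G) hT (by omega) a
        linarith
      rw [max_eq_left h3]
      refine startEpoch_inv a hs.m_le (by positivity) ?_ h3
      have : 0 ≤ 4 * (P.parts.card : ℝ) * s.η := by positivity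
      linarith [hs.η_le]
    · refine ⟨hs.m_le, hs.η_pos, hs.η_le, hs.ε_eq, hs.le_ε, rfl, Or.inl ?_, fun i => ?_,
        not_le.1 h1⟩
      · change clip P s.ε _ = _
        rw [hs.ε_eq]
      · exact add_nonneg (hs.cum_nonneg i) (exploreEstimate_nonneg (hs.p_spec a).1 hl a i)
  · exact (omdStep_spec (isCompact_clippedSimplex K T) (convex_clippedSimplex K T)
      (fun q hq => differentiableAt_reg2 hT hq) _ _ hs).1

/-- The value of the potential after a round of the first stage. -/
theorem explore_update_potential_le (hG : SelfAware G) (hP : IsCliquePartition G P)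
    (hT : 0 < T) (hKT : 2 * K ≤ T) (hκ : 0 < P.parts.card) {l : Fin T → Fin K → ℝ}
    (hl : ∀ t i, l t i ∈ Set.Icc (0 : ℝ) 1) (hc : 1 ≤ c) (hcT : 1 / 2 + Real.log T ≤ c)
    (hcK : Real.log K ≤ c)
    (hB : Budget T G P.parts.card c lam (totalLoss l best) A b) {s : ExploreState K}
    (hs : ExploreInv T G P s) (t : Fin T) (a : Fin K) :
    twoStagePotential G P l c lam A b best (t + 1)
      (exploreUpdate T G P (1 / (4 * (P.parts.card : ℝ))) (1 / (2 * (P.parts.card : ℝ))) s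
        (feedback G (l t) a)) ≤
      explorePotential P c lam A b best (remainingLoss l best (t + 1)) s -
        ∑ i, s.p i * exploreEstimate G s.p (l t) a i +
        (1 + b s.m) * exploreEstimate G s.p (l t) a best := by
  have hη := hs.η_pos
  have hκ' : (0 : ℝ) < P.parts.card := by exact_mod_cast hκ
  have hα : (0 : ℝ) < independenceNumber G := by exact_mod_cast one_le_independenceNumber G best
  have hT' : (0 : ℝ) < T := by exact_mod_cast hT
  obtain ⟨hr1, hr2⟩ := hs.round (best := best) hG hP (hl t) hc hcT hT a rfl
  rw [exploreUpdate_eq hs]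
  set e := exploreEstimate G s.p (l t) a
  have he0 : ∀ i, 0 ≤ e i := exploreEstimate_nonneg (hs.p_spec a).1 (hl t) a
  have hrem := remainingLoss_mem (l := l) (fun τ => (hl τ best).1) (t + 1)
  set r := remainingLoss l best (t + 1) with hr
  have hbm := hB.b_nonneg s.m
  have hy : 0 ≤ s.cum best + e best := add_nonneg (hs.cum_nonneg best) (he0 best)
  have hG0 : 0 ≤ laterEpochsBudget c lam (1 / s.η) := laterEpochsBudget_nonneg (by linarith)
  -- A triggered test bounds the estimated loss of every arm from below, in particular that of the
  -- comparator; this is the money on which the price `b` is collected.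
  have htrig : 1 / s.η ≤ 4 * s.η * P.parts.card * ⨅ i, (s.cum + e) i →
      (1 / s.η) ^ 2 ≤ 4 * P.parts.card * (s.cum best + e best) := fun h => by
    have h1 := h.trans (mul_le_mul_of_nonneg_left (iInf_apply_le (s.cum + e) best)
      (by positivity))
    rw [Pi.add_apply] at h1
    have h2 := mul_le_mul_of_nonneg_left h1 (by positivity : 0 ≤ 1 / s.η)
    rw [sq]
    refine h2.trans (le_of_eq ?_)
    field_simp
  have hsqrt : √(1 / ((independenceNumber G : ℝ) * T)) =
      1 / √((independenceNumber G : ℝ) * T) := by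
    rw [Real.sqrt_div zero_le_one, Real.sqrt_one]
  have hsq : 0 < √((independenceNumber G : ℝ) * T) := by positivity
  unfold explorePotential
  split_ifs with h1 h2
  · have h3 := htrig h1
    have h4 : (independenceNumber G : ℝ) * T ≤ 16 * P.parts.card * (s.cum best + e best) := by
      have h5 : √((independenceNumber G : ℝ) * T) ≤ 2 * (1 / s.η) := by
        rw [hsqrt, le_div_iff₀ hsq] at h2
        rw [mul_one_div, le_div_iff₀ hη]
        linarith
      have h6 := pow_le_pow_left₀ hsq.le h5 2
      rw [Real.sq_sqrt (by positivity), mul_pow] at h6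
      linarith
    unfold startMetaEpoch
    split_ifs with hm
    · have h5 := startEpoch_potential_le (G := G) (P := P) (l := l) (lam := lam) (A := A) (b := b)
        (best := best) (m := s.m + 1) (η := 1 / (4 * (P.parts.card : ℝ)))
        (ε := 1 / (2 * (P.parts.card : ℝ))) (by positivity) (le_of_eq (by field_simp)) hc hcK
        (t + 1)
      rw [one_div_one_div] at h5
      have h6 := hB.metaEpoch s.m _ r hm h4 hrem.1 hrem.2
      linarith
    · have h5 := exploitPotential_argminOn_le (G := G) (best := best) hT (by omega : K ≤ T)
        (t + 1)
      have hm' : s.m = Nat.log 2 T := by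
        have := hs.m_le
        omega
      have h6 := hB.exploit _ r h4 hrem.1
      rw [← hm'] at h6
      change exploitPotential T G best (t + 1) _ ≤ _
      linarith
  · have h3 := htrig h1
    have h4 : 2 * (1 / s.η) < √((independenceNumber G : ℝ) * T) := by
      rw [hsqrt, not_le, div_lt_iff₀ hsq] at h2
      rw [mul_one_div, div_lt_iff₀ hη]
      linarith
    have h5 := hB.epoch _ _ s.m (by positivity) hy h3 h4
    have h6 := startEpoch_potential_le (G := G) (P := P) (l := l) (lam := lam) (A := A) (b := b)
      (best := best) (m := s.m) (η := s.η / 2)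
      (ε := max (2 * (s.η / 2)) (1 / T)) (by positivity)
      (by
        have : 0 ≤ 4 * (P.parts.card : ℝ) * s.η := by positivity
        linarith [hs.η_le]) hc hcK (t + 1)
    have h7 : 1 / (s.η / 2) = 2 * (1 / s.η) := by field_simp
    rw [h7] at h6
    linarith
  · change epochPotential P c s.η best (s.cum + e) + firstRoundBudget P (s.cum + e) +
      laterEpochsBudget c lam (1 / s.η) + A s.m + b s.m * ((s.cum + e) best + r) ≤ _
    rw [Pi.add_apply]
    linarith

/-- The round-by-round estimates hold for each drawn arm; only here is the expectation taken. The
comparator's estimate enters with factor `1 + b`, once from the regret and once from the price, and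
has mean at most its true loss. -/
theorem regret_le_of_budget (hG : SelfAware G) (hP : IsCliquePartition G P)
    (hT : 2 ≤ T) (hKT : 2 * K ≤ T) (hκ : 0 < P.parts.card) {l : Fin T → Fin K → ℝ}
    (hl : ∀ t i, l t i ∈ Set.Icc (0 : ℝ) 1) (hc : 1 ≤ c) (hcT : 1 / 2 + Real.log T ≤ c)
    (hcK : Real.log K ≤ c)
    (hB : Budget T G P.parts.card c lam (totalLoss l best) A b) :
    (twoStage T G P (1 / (4 * (P.parts.card : ℝ))) (1 / (2 * (P.parts.card : ℝ)))).regret G l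
      best ≤ 24 * c * P.parts.card + laterEpochsBudget c lam (4 * P.parts.card) + A 1 +
        b 1 * totalLoss l best := by
  have hT0 : 0 < T := by omega
  have hκ' : (0 : ℝ) < P.parts.card := by exact_mod_cast hκ
  refine (Learner.regret_le_of_potential G best T _ l (TwoStageInv T G P)
    (twoStagePotential G P l c lam A b best) (startMetaEpoch_inv hT0 hKT hκ best 1) ?_ ?_ ?_
      ?_).2.trans ?_
  · rintro (s | p) hs
    · exact ExploreInv.p_spec hs best
    · exact ⟨hs.1.1, hs.1.2⟩
  · exact fun t s a hs => TwoStageInv.update hT0 hKT hκ (hl t) s a hs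
  · rintro t (s | p) hs
    · change ExploreInv T G P s at hs
      obtain ⟨hp0, hp1⟩ := hs.p_spec best
      have h1 := Finset.sum_le_sum (s := Finset.univ) fun (a : Fin K) _ =>
        mul_le_mul_of_nonneg_left (add_le_add (le_refl (l t a - l t best))
          (explore_update_potential_le hG hP hT0 hKT hκ hl hc hcT hcK hB hs t a)) (hp0 a)
      refine h1.trans ?_
      set E := explorePotential P c lam A b best (remainingLoss l best (t + 1)) s
      have h2 : ∀ a, s.p a * (l t a - l t best + (E -
          ∑ i, s.p i * exploreEstimate G s.p (l t) a i +
          (1 + b s.m) * exploreEstimate G s.p (l t) a best)) =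
          s.p a * l t a + s.p a * (E - l t best) -
          s.p a * ∑ i, s.p i * exploreEstimate G s.p (l t) a i +
          (1 + b s.m) * (s.p a * exploreEstimate G s.p (l t) a best) := fun a => by ring
      simp_rw [h2]
      rw [Finset.sum_add_distrib, Finset.sum_sub_distrib, Finset.sum_add_distrib,
        ← Finset.sum_mul, hp1, ← Finset.mul_sum, sum_mul_sum_exploreEstimate hG hp0,
        sum_mul_exploreEstimate hG hp0]
      have h3 : (if 0 < s.p best then l t best else 0) ≤ l t best := by
        split_ifs
        exacts [le_rfl, (hl t best).1]
      have h4 := mul_le_mul_of_nonneg_left h3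
        (by linarith [hB.b_nonneg s.m] : 0 ≤ 1 + b s.m)
      have h5 : twoStagePotential G P l c lam A b best t (.explore s) =
          E + b s.m * l t best := by
        change explorePotential P c lam A b best (remainingLoss l best t) s = _
        rw [remainingLoss_eq]
        simp only [E, explorePotential]
        ring
      rw [h5]
      linarith
    · exact exploitPotential_step hG hT0 (by omega) (hl t) hs t
  · rintro (s | p) hs
    · have h1 : 0 ≤ epochPotential P c s.η best s.cum := ExploreInv.potential_nonneg hs hc
      have h2 := firstRoundBudget_nonneg (P := P) s.cum
      have h3 : 0 ≤ laterEpochsBudget c lam (1 / s.η) := laterEpochsBudget_nonneg (by linarith)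
      have h4 := hB.A_nonneg s.m hs.m_le
      have h5 := hB.b_nonneg s.m
      have h6 := (remainingLoss_mem (l := l) (i := best) (fun τ => (hl τ best).1) T).1
      have h7 := hs.cum_nonneg best
      change 0 ≤ explorePotential P c lam A b best (remainingLoss l best T) s
      unfold explorePotential
      positivity
    · have := bregman_reg2_nonneg (G := G) hT0 (comparator_mem hT0 (by omega : K ≤ T) best) hs
      change 0 ≤ exploitPotential T G best T p
      unfold exploitPotential
      rw [sub_self, zero_mul, add_zero]
      exact this
  · change twoStagePotential G P l c lam A b best 0 (startMetaEpoch T G _ _ 1) ≤ _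
    unfold startMetaEpoch
    rw [if_pos (show 1 ≤ Nat.log 2 T from Nat.log_pos (by norm_num) hT)]
    have h5 := startEpoch_potential_le (G := G) (P := P) (l := l) (lam := lam) (A := A) (b := b)
      (best := best) (m := 1) (η := 1 / (4 * (P.parts.card : ℝ)))
      (ε := 1 / (2 * (P.parts.card : ℝ))) (by positivity) (le_of_eq (by field_simp)) hc hcK 0
    rw [one_div_one_div, remainingLoss_zero] at h5
    linarith

end

/-! ### The two regret bounds -/

theorem laterEpochsBudget_le {c lam x : ℝ} (hc : 0 ≤ c) (hlam : 0 ≤ lam) (hx : 0 ≤ x) :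
    laterEpochsBudget c lam x ≤ 24 * c * lam := by
  unfold laterEpochsBudget
  have := mul_le_mul_of_nonneg_left
    (max_le (by positivity) (by linarith) : max 0 (2 * lam - x) ≤ 2 * lam)
    (by positivity : 0 ≤ 12 * c)
  linarith

/-- The geometric series of epoch costs under doubling of the inverse rate, in telescoped form; it
breaks off once `x` exceeds `lam`. -/
theorem laterEpochsBudget_two_mul {c lam x : ℝ} (hx : 0 ≤ x) (hxl : x ≤ lam) :
    12 * c * x + laterEpochsBudget c lam (2 * x) = laterEpochsBudget c lam x := by
  unfold laterEpochsBudget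
  rw [max_eq_right (by linarith), max_eq_right (by linarith)]
  ring

theorem log_two_le {T : ℕ} (hT : 2 ≤ T) : (Nat.log 2 T : ℝ) ≤ 2 * Real.log T := by
  have h1 : (2 : ℝ) ^ Nat.log 2 T ≤ T := by
    exact_mod_cast Nat.pow_log_le_self 2 (by omega : T ≠ 0)
  have h2 := Real.log_le_log (by positivity) h1
  rw [Real.log_pow] at h2
  have h3 := Real.log_two_gt_d9
  have h4 : (0 : ℝ) ≤ Nat.log 2 T := Nat.cast_nonneg _
  nlinarith

section

variable {K T : ℕ} {G : Digraph (Fin K)} {P : Finpartition (Finset.univ : Finset (Fin K))}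
  {c : ℝ}

theorem exploitBudget_nonneg : 0 ≤ exploitBudget T G := by
  have : 0 ≤ Real.log T := Real.log_natCast_nonneg T
  unfold exploitBudget
  positivity

theorem exploitBudget_le (hK : 1 ≤ K) (hT : 2 ≤ T) (hc : 1 ≤ c) (hcT : Real.log T ≤ c) :
    exploitBudget T G ≤ 7 * c * √((independenceNumber G : ℝ) * T) + 65 * c * K ^ 2 := by
  have h1 := log_two_le hT
  have hK' : (1 : ℝ) ≤ K := by exact_mod_cast hK
  unfold exploitBudget
  have ha : 0 ≤ √((independenceNumber G : ℝ) * T) := Real.sqrt_nonneg _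
  set a := √((independenceNumber G : ℝ) * T)
  have h2 := mul_le_mul_of_nonneg_left hcT ha
  have h3 := mul_le_mul_of_nonneg_left hcT (by positivity : 0 ≤ 64 * (K : ℝ) ^ 2)
  have h4 : (Nat.log 2 T : ℝ) + 1 ≤ 3 * c := by linarith
  have h5 := mul_le_mul_of_nonneg_left h4 (by positivity : 0 ≤ 2 * a)
  have h6 : (K : ℝ) ≤ c * K ^ 2 := by nlinarith
  linarith

/-- The regret bound in terms of the independence number. -/
theorem regret_le_sqrt_independenceNumber (hG : SelfAware G) (hP : IsCliquePartition G P)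
    (hK : 1 ≤ K) (hT : 2 ≤ T) (hKT : 2 * K ≤ T) (hκ : 0 < P.parts.card) {l : Fin T → Fin K → ℝ}
    (hl : ∀ t i, l t i ∈ Set.Icc (0 : ℝ) 1) (hc : 1 ≤ c) (hcT : 1 / 2 + Real.log T ≤ c)
    (hcK : Real.log K ≤ c) (best : Fin K) :
    (twoStage T G P (1 / (4 * (P.parts.card : ℝ))) (1 / (2 * (P.parts.card : ℝ)))).regret G l
      best ≤ c ^ 2 * (55 * √((independenceNumber G : ℝ) * T) + 305 * K ^ 2) := by
  have hS := exploitBudget_le (G := G) hK hT hc (by linarith)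
  have hS0 := exploitBudget_nonneg (T := T) (G := G)
  have ha : 0 ≤ √((independenceNumber G : ℝ) * T) := Real.sqrt_nonneg _
  set a := √((independenceNumber G : ℝ) * T) with ha'
  set κ : ℝ := (P.parts.card : ℝ) with hκ'
  have hκ0 : 0 < κ := Nat.cast_pos.2 hκ
  have hκK : κ ≤ K := by
    have : P.parts.card ≤ K := by simpa using P.card_parts_le_card
    exact Nat.cast_le.2 this
  have hK' : (1 : ℝ) ≤ K := by exact_mod_cast hK
  set D := 24 * c * κ + 24 * c * (4 * κ + a) with hD
  have hD0 : 0 ≤ D := by positivity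
  have hG4 := laterEpochsBudget_le (c := c) (lam := 4 * κ + a) (x := 4 * κ) (by linarith)
    (by positivity) (by positivity)
  -- No price is needed: epochs continue only while `2x < √(αT)`, so `x` never passes `lam` and the
  -- geometric budget pays for all of them.
  have hB : Budget T G κ c (4 * κ + a) (totalLoss l best)
      (fun m => ((Nat.log 2 T : ℝ) - m) * D + exploitBudget T G) fun _ => 0 := by
    refine ⟨fun m hm => ?_, fun m => le_rfl, ?_, ?_, ?_⟩
    · have : (0 : ℝ) ≤ (Nat.log 2 T : ℝ) - m := sub_nonneg.2 (by exact_mod_cast hm)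
      positivity
    · intro x y _ hx _ _ hxa
      rw [← ha'] at hxa
      rw [zero_mul, add_zero, laterEpochsBudget_two_mul hx.le (by linarith)]
    · intro n y r _ _ _ _
      push_cast
      linarith
    · intro y r _ _
      simp
  refine (regret_le_of_budget hG hP hT hKT hκ hl hc hcT hcK hB).trans ?_
  rw [← hκ', zero_mul, add_zero]
  have h1 : (Nat.log 2 T : ℝ) * D ≤ 2 * c * D :=
    mul_le_mul_of_nonneg_right (by linarith [log_two_le hT]) hD0
  have h2 : c ≤ c ^ 2 := le_self_pow₀ hc two_ne_zero
  have h3 := mul_le_mul_of_nonneg_right h2 (by positivity : 0 ≤ 7 * a + 65 * (K : ℝ) ^ 2)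
  have h4 : κ ≤ (K : ℝ) ^ 2 := hκK.trans (le_self_pow₀ hK' two_ne_zero)
  have h5 := mul_le_mul_of_nonneg_left h4 (by positivity : 0 ≤ 240 * c ^ 2)
  have h6 : 2 * c * D = 240 * c ^ 2 * κ + 48 * c ^ 2 * a := by
    rw [hD]
    ring
  push_cast
  linarith

/-- The small-loss regret bound. -/
theorem regret_le_sqrt_totalLoss (hG : SelfAware G) (hP : IsCliquePartition G P)
    (hK : 1 ≤ K) (hT : 2 ≤ T) (hKT : 2 * K ≤ T) (hκ : 0 < P.parts.card) {l : Fin T → Fin K → ℝ}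
    (hl : ∀ t i, l t i ∈ Set.Icc (0 : ℝ) 1) (hc : 1 ≤ c) (hcT : 1 / 2 + Real.log T ≤ c)
    (hcK : Real.log K ≤ c) {best : Fin K}
    (hsmall : 32 * (P.parts.card * totalLoss l best) ≤ (independenceNumber G : ℝ) * T) :
    (twoStage T G P (1 / (4 * (P.parts.card : ℝ))) (1 / (2 * (P.parts.card : ℝ)))).regret G l
      best ≤ c ^ 2 * (96 * √(P.parts.card * totalLoss l best) + 175 * K ^ 2) := by
  have hS := exploitBudget_le (G := G) hK hT hc (by linarith)
  have hS0 := exploitBudget_nonneg (T := T) (G := G)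
  have hL0 : 0 ≤ totalLoss l best := Finset.sum_nonneg fun t _ => (hl t best).1
  have hα : (0 : ℝ) < independenceNumber G := by exact_mod_cast one_le_independenceNumber G best
  have hT' : (2 : ℝ) ≤ T := by exact_mod_cast hT
  have hαT : (independenceNumber G : ℝ) ≤ T := by
    exact_mod_cast (independenceNumber_le G).trans (by omega : K ≤ T)
  have haT : √((independenceNumber G : ℝ) * T) ≤ T := by
    rw [Real.sqrt_le_left (by positivity), sq]
    gcongr
  set L := totalLoss l best
  set κ : ℝ := (P.parts.card : ℝ) with hκ'
  have hκ0 : 0 < κ := Nat.cast_pos.2 hκ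
  have hκK : κ ≤ K := by
    have : P.parts.card ≤ K := by simpa using P.card_parts_le_card
    exact Nat.cast_le.2 this
  have hK' : (1 : ℝ) ≤ K := by exact_mod_cast hK
  have hR : 0 ≤ √(κ * L) := Real.sqrt_nonneg _
  have hRsq : √(κ * L) ^ 2 = κ * L := Real.sq_sqrt (by positivity)
  set R := √(κ * L)
  set S := exploitBudget T G
  set M := Nat.log 2 T with hM
  set N := (independenceNumber G : ℝ) * T
  have hN : 0 < N := by positivity
  set D := 24 * c * κ + 24 * c * (R + κ) with hD
  have hD0 : 0 ≤ D := by positivity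
  -- Pays for epochs with `x ≥ R + κ`: there `x (R + κ) ≤ x² ≤ 4κy`, so `12 c x ≤ w y`. In total
  -- this price costs at most `48 c R`.
  set w := 48 * c * κ / (R + κ) with hw
  have hw0 : 0 ≤ w := by positivity
  -- Chosen so that `v y` covers the second stage whenever the last meta-epoch ends, that is, when
  -- `N ≤ 16 κ y`.
  set v := S * (16 * κ) / N with hv
  have hv0 : 0 ≤ v := by positivity
  have hvy : ∀ y, N ≤ 16 * κ * y → S ≤ v * y := fun y hy => by
    rw [hv, div_mul_eq_mul_div, le_div_iff₀ hN]
    have := mul_le_mul_of_nonneg_left hy hS0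
    linarith
  have hG4 := laterEpochsBudget_le (c := c) (lam := R + κ) (x := 4 * κ) (by linarith)
    (by positivity) (by positivity)
  have hB : Budget T G κ c (R + κ) L (fun m => ((M : ℝ) - m) * D)
      fun m => w + v * (1 / 2) ^ (M - m) := by
    refine ⟨fun m hm => ?_, fun m => by positivity, ?_, ?_, ?_⟩
    · have : (0 : ℝ) ≤ (M : ℝ) - m := sub_nonneg.2 (by exact_mod_cast hm)
      positivity
    · intro x y n hx hy hxy _
      have h0 : 0 ≤ v * (1 / 2) ^ (M - n) * y := by positivity
      have h1 : 0 ≤ w * y := by positivity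
      rcases le_total x (R + κ) with h | h
      · rw [laterEpochsBudget_two_mul hx.le h]
        linarith
      · have h2 : laterEpochsBudget c (R + κ) (2 * x) = 0 := by
          unfold laterEpochsBudget
          rw [max_eq_left (by linarith), mul_zero]
        have h3 : 0 ≤ laterEpochsBudget c (R + κ) x := laterEpochsBudget_nonneg (by linarith)
        have h4 : 12 * c * x ≤ w * y := by
          rw [hw, div_mul_eq_mul_div, le_div_iff₀ (by positivity)]
          have h5 : x * (R + κ) ≤ 4 * κ * y := by
            refine le_trans ?_ hxy
            rw [sq]
            exact mul_le_mul_of_nonneg_left h hx.le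
          have := mul_le_mul_of_nonneg_left h5 (by positivity : 0 ≤ 12 * c)
          linarith
        linarith
    · intro n y r hn hy hr hrL
      have h1 : M - n = (M - (n + 1)) + 1 := by omega
      rw [h1, pow_succ]
      have h2 : 0 ≤ v * (1 / 2 : ℝ) ^ (M - (n + 1)) := by positivity
      -- Here the constant 32 of `hsmall` enters: ending a meta-epoch needs `y ≥ 2L ≥ 2r`. Hence `r`
      -- is at most half of `y + r`, and the price can double.
      have h3 : 2 * r ≤ y := by
        have h4 : κ * r ≤ κ * L := by gcongr
        have h5 : κ * (2 * r) ≤ κ * y := by linarith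
        exact le_of_mul_le_mul_left h5 hκ0
      have h6 : 0 ≤ w * y := mul_nonneg hw0 (by linarith)
      have h7 := mul_le_mul_of_nonneg_left (by linarith : r ≤ 1 / 2 * (y + r)) h2
      push_cast
      linarith
    · intro y r hy hr
      have h1 := hvy y hy
      have hy0 : 0 ≤ y := by
        refine nonneg_of_mul_nonneg_right (hN.le.trans hy) (by positivity)
      have h2 : 0 ≤ w * (y + r) := by positivity
      have h3 : 0 ≤ v * r := by positivity
      change S ≤ ((M : ℝ) - M) * D + (w + v * (1 / 2) ^ (M - M)) * (y + r)
      rw [sub_self, Nat.sub_self, pow_zero]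
      linarith
  refine (regret_le_of_budget hG hP hT hKT hκ hl hc hcT hcK hB).trans ?_
  rw [← hκ']
  have h1 : (M : ℝ) * D ≤ 2 * c * D :=
    mul_le_mul_of_nonneg_right (by linarith [log_two_le hT]) hD0
  have h2 : c ≤ c ^ 2 := le_self_pow₀ hc two_ne_zero
  have h4 : κ ≤ (K : ℝ) ^ 2 := hκK.trans (le_self_pow₀ hK' two_ne_zero)
  have h5 := mul_le_mul_of_nonneg_left h4 (by positivity : 0 ≤ 96 * c ^ 2)
  have h6 : 2 * c * D = 96 * c ^ 2 * κ + 48 * c ^ 2 * R := by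
    rw [hD]
    ring
  have h7 : w * L ≤ 48 * c * R := by
    rw [hw, div_mul_eq_mul_div, div_le_iff₀ (by positivity)]
    have h8 : κ * L ≤ R * (R + κ) := by
      rw [← hRsq, sq]
      exact mul_le_mul_of_nonneg_left (by linarith) hR
    have := mul_le_mul_of_nonneg_left h8 (by positivity : 0 ≤ 48 * c)
    linarith
  -- The expected cost of the second stage: its budget `S` times `O(1/T)`. Since `√(αT) ≤ T`, only a
  -- term of order `c K²` survives.
  have h8 : v * (1 / 2) ^ (M - 1) * L ≤ 79 * c * K ^ 2 := by
    have hM1 : 1 ≤ M := Nat.log_pos (by norm_num) hT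
    have h9 : v * L ≤ S / 2 := by
      rw [hv, div_mul_eq_mul_div, div_le_div_iff₀ hN (by norm_num)]
      have := mul_le_mul_of_nonneg_left hsmall hS0
      linarith
    have h10 : (1 / 2 : ℝ) ^ (M - 1) ≤ 4 / T := by
      have h11 : T < 2 ^ (M + 1) := Nat.lt_pow_succ_log_self (by norm_num) T
      have h12 : (T : ℝ) < 2 ^ (M + 1) := by exact_mod_cast h11
      have h13 : M + 1 = (M - 1) + 2 := by omega
      rw [h13, pow_add] at h12
      rw [one_div, inv_pow, ← one_div, div_le_div_iff₀ (by positivity) (by positivity)]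
      linarith
    have h14 : v * (1 / 2) ^ (M - 1) * L ≤ S / 2 * (4 / T) := by
      have h15 := mul_le_mul h9 h10 (by positivity) (by positivity : 0 ≤ S / 2)
      linarith
    refine h14.trans ?_
    have h16 : S / 2 * (4 / T) = 2 * S / T := by ring
    rw [h16, div_le_iff₀ (by positivity)]
    have h17 := mul_le_mul_of_nonneg_left haT (by positivity : 0 ≤ 14 * c)
    have h18 : (1 : ℝ) ≤ K ^ 2 := one_le_pow₀ hK'
    have h19 := mul_le_mul_of_nonneg_left h18 (by positivity : 0 ≤ 14 * c * T)
    have h20 := mul_le_mul_of_nonneg_left hT' (by positivity : 0 ≤ 65 * c * (K : ℝ) ^ 2)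
    linarith
  have h21 := mul_le_mul_of_nonneg_right h2 (by positivity : 0 ≤ 48 * R + 79 * (K : ℝ) ^ 2)
  push_cast
  linarith

theorem regret_le_min (hG : SelfAware G) (hP : IsCliquePartition G P)
    (hK : 2 ≤ K) (hKT : 2 * K ≤ T) {l : Fin T → Fin K → ℝ}
    (hl : ∀ t i, l t i ∈ Set.Icc (0 : ℝ) 1) (best : Fin K) :
    (twoStage T G P (1 / (4 * (P.parts.card : ℝ))) (1 / (2 * (P.parts.card : ℝ)))).regret G l
      best ≤ 400 * Real.log (K * T) ^ 2 * (min √((independenceNumber G : ℝ) * T)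
        √((P.parts.card : ℝ) * totalLoss l best) + (K : ℝ) ^ 2) := by
  have hK' : (2 : ℝ) ≤ K := by exact_mod_cast hK
  have hT' : (4 : ℝ) ≤ T := by exact_mod_cast (by omega : 4 ≤ T)
  have hlog : Real.log (K * T) = Real.log K + Real.log T :=
    Real.log_mul (by positivity) (by positivity)
  have h2 := Real.log_two_gt_d9
  have hK2 : Real.log 2 ≤ Real.log K := Real.log_le_log (by norm_num) hK'
  have hT2 : Real.log 2 ≤ Real.log T := Real.log_le_log (by norm_num) (by linarith)
  have hκ : 0 < P.parts.card := Finset.card_pos.2 ⟨_, P.part_mem.2 (Finset.mem_univ best)⟩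
  have hL0 : 0 ≤ totalLoss l best := Finset.sum_nonneg fun t _ => (hl t best).1
  set c := Real.log (K * T)
  set N := (independenceNumber G : ℝ) * T
  have hN0 : 0 ≤ N := by positivity
  set X := (P.parts.card : ℝ) * totalLoss l best with hX
  have hX0 : 0 ≤ X := by positivity
  rcases le_total (32 * X) N with h | h
  · refine (regret_le_sqrt_totalLoss hG hP (by omega) (by omega) hKT hκ hl (c := c)
      (by linarith) (by linarith) (by linarith) h).trans ?_
    rw [min_eq_right (Real.sqrt_le_sqrt (by linarith)), mul_comm 400, mul_assoc]
    refine mul_le_mul_of_nonneg_left ?_ (sq_nonneg c)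
    have := Real.sqrt_nonneg X
    have : 0 ≤ (K : ℝ) ^ 2 := by positivity
    linarith
  · refine (regret_le_sqrt_independenceNumber hG hP (by omega) (by omega) hKT hκ hl (c := c)
      (by linarith) (by linarith) (by linarith) best).trans ?_
    rw [mul_comm 400, mul_assoc]
    refine mul_le_mul_of_nonneg_left ?_ (sq_nonneg c)
    -- `√32 < 6`.
    have h3 : √N ≤ 6 * min √N √X := by
      have h4 : √N ≤ 6 * √X := by
        rw [Real.sqrt_le_left (by positivity), mul_pow, Real.sq_sqrt hX0]
        linarith
      rcases min_cases √N √X with h5 | h5 <;> rw [h5.1] <;> linarith [Real.sqrt_nonneg N]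
    have : 0 ≤ (K : ℝ) ^ 2 := by positivity
    linarith [Real.sqrt_nonneg N]

end

end GraphBandit

end

theorem mainTheorem2 :
    ∃ (c : ℝ) (d : ℕ), 0 < c ∧
      ∀ (K T : ℕ), 2 ≤ K → 2 * K ≤ T →
      ∀ (G : Digraph (Fin K)), GraphBandit.SelfAware G →
      ∀ (P : Finpartition (Finset.univ : Finset (Fin K))), GraphBandit.IsCliquePartition G P →
      ∀ (l : Fin T → Fin K → ℝ), (∀ t i, l t i ∈ Set.Icc (0 : ℝ) 1) →
      ∀ (best : Fin K), (∀ i, GraphBandit.totalLoss l best ≤ GraphBandit.totalLoss l i) →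
        (GraphBandit.twoStage T G P (1 / (4 * (P.parts.card : ℝ)))
            (1 / (2 * (P.parts.card : ℝ)))).regret G l best
          ≤ c * Real.log (K * T) ^ d *
            (min √((GraphBandit.independenceNumber G : ℝ) * T)
                √((P.parts.card : ℝ) * GraphBandit.totalLoss l best) + (K : ℝ) ^ 2) ∧
        (P.parts.card = GraphBandit.cliquePartitionNumber G →
          (GraphBandit.twoStage T G P (1 / (4 * (GraphBandit.cliquePartitionNumber G : ℝ)))
              (1 / (2 * (GraphBandit.cliquePartitionNumber G : ℝ)))).regret G l best
            ≤ c * Real.log (K * T) ^ d *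
              (min √((GraphBandit.independenceNumber G : ℝ) * T)
                  √((GraphBandit.cliquePartitionNumber G : ℝ) * GraphBandit.totalLoss l best)
                + (K : ℝ) ^ 2)) := by
  refine ⟨400, 2, by norm_num, ?_⟩
  intro K T hK hKT G hG P hP l hl best _
  have h := GraphBandit.regret_le_min hG hP hK hKT hl best
  exact ⟨h, fun hκ => hκ ▸ h⟩
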